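/- **Input and model.** Let $m\ge 2$, let $\alpha_L,\alpha_R,\beta_L,\beta_R\in[0,1)$ and $\epsilon,\gamma\in(0,1)$. The input is a list of finite sets $A_1,\dots,A_m$, each with a real number $m_i\in[(1-\beta_L)|A_i|,(1+\beta_R)|A_i|]$ and a random generator that returns elements of $A_i$ only, each $x\in A_i$ with probability in $\left[\frac{1-\alpha_L}{|A_i|},\frac{1+\alpha_R}{|A_i|}\right]$. Put $M=m_1+\dots+m_m$. An algorithm knows $m$, the $m_i$, $M$, $\epsilon$ and $\gamma$; it reaches the sets only in rounds. In one round it sends a batch of requests for (independent) random elements of the sets and of membership queries "$x\in A_i$?", chosen before any answer of that round is known. Each request, each random draw and each elementary local step costs one unit of time. **Algorithm.** Let $f_1=8$, $z_{\min}=1$, $z_{\max}=m$, and $$\epsilon_0=\tfrac{\epsilon}{9},\ \epsilon_1=\tfrac{\epsilon_0}{6\log_2 m},\ \epsilon_2=\tfrac{\epsilon_1}{4},\ \epsilon_3=\tfrac{\epsilon_0}{3},\ \delta=\tfrac{\epsilon_2}{2},\ \gamma_2=\tfrac{\gamma}{6\log_2 m},$$ $$f_2=\frac{2v}{\epsilon_3}+\frac{2\log_2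 (m/z_{\min})}{\epsilon_3\log_2(1+\delta)},\quad f_3=f_1\frac{6\ln(2/\gamma_2)}{\epsilon_2^2},\quad f_4=\frac{f_2\log_2(m^2/\epsilon_1)}{6\epsilon_1^2}+\frac{f_3}{\epsilon_2f_1},$$ $$f_5=\frac{m f_4}{z_{\min}},\quad \gamma_3=\frac{\gamma_2}{2f_5},\quad f_6=f_1\frac{24}{\epsilon_1^2}\ln\frac{2}{\gamma_3},$$ where $v$ is the number of intervals $[(1+\delta)^{i-1},(1+\delta)^i)$, $i\ge1$, that meet $[z_{\min},z_{\max}]$. The algorithm ApproximateUnion sets $h_1=\lceil f_5\rceil$, obtains in one round a list $R_1$ of $h_1$ independent samples, each by selecting an index $i$ with probability $m_i/M$ and then taking a random element of $A_i$, and sets $c_1=z_{\max}$, $s_1'=1/h_1$, $sum=0$. Stage $i=1,2,\dots$ is as follows. Let $u_i=\lceil (m/c_i)f_6\rceil$; select a list $H_i$ of $u_i$ independent uniform indices from $\{1,\dots,m\}$; in one round query $x\in A_k$ for all $x\in R_i$, $k\in H_i$; let $S(x,H_i)$ be the number of $k\in H_i$ (with multiplicity) with $x\in A_k$; let $V_i$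 be the sublist of those $x\in R_i$ with $S(x,H_i)\ge \frac{c_i}{2f_1m}u_i$; add $s_i'\sum_{x\in V_i}\frac{u_i}{S(x,H_i)m}$ to $sum$; let $c_{i+1}=c_i/f_1$ and $h_{i+1}=\lceil h_1c_{i+1}/m\rceil$. If $|R_i|-|V_i|<h_{i+1}$, let $R_{i+1}=R_i-V_i$ and $s_{i+1}'=s_i'$; otherwise let $R_{i+1}$ consist of $h_{i+1}$ independent uniform samples from $R_i-V_i$ and let $s_{i+1}'=s_i'\frac{|R_i|-|V_i|}{h_{i+1}}$. If $c_{i+1}<z_{\min}$, return $sum\cdot M$ and stop; otherwise go to stage $i+1$. **Statement.** There are a real polynomial $P$ in two variables and constants $k\in\mathbb N$, $C\in\mathbb R$ such that for all such inputs every run of this algorithm takes time at most $P\!\left(\frac1\epsilon,\ln\frac1\gamma\right)\cdot m\cdot(\log_2 m)^{k}$ and at most $C\log_2 m$ rounds, and with probability at least $1-\gamma$ its output satisfies $$sum\cdot M\in\bigl[(1-\epsilon)(1-\alpha_L)(1-\beta_L)\,|A_1\cup\dots\cup A_m|,\ (1+\epsilon)(1+\alpha_R)(1+\beta_R)\,|A_1\cup\dots\cup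 A_m|\bigr].$$ -/

import Mathlib

/-!
Approximate set union in the client-server model: the input lists, the model of randomized
computation with its time and round counters, and the algorithm ApproximateUnion.
-/

namespace SetUnion

universe u v w

/-- A list of `m` finite sets `A i`, each with an approximate size `size i` in
`[(1 - βL)|A i|, (1 + βR)|A i|]` and a biased random generator `gen i`, which outputs only elements
of `A i`, every one of them with probability in `[(1 - αL)/|A i|, (1 + αR)/|A i|]`. -/
structure ApproxList (m : ℕ) (U : Type u) (αL αR βL βR : ℝ) where
  A : Fin m → Finset U
  size : Fin m → ℝ
  gen : Fin m → PMF U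
  size_mem : ∀ i, size i ∈ Set.Icc ((1 - βL) * (A i).card) ((1 + βR) * (A i).card)
  gen_eq_zero : ∀ i, ∀ x, x ∉ A i → gen i x = 0
  gen_mem : ∀ i, ∀ x ∈ A i,
    (gen i x).toReal ∈ Set.Icc ((1 - αL) / (A i).card) ((1 + αR) / (A i).card)

/-- Algorithms of a server that has access to `m` client sets with elements in `U` and that returns
a value in `β`. The sets and their generators are not visible to an algorithm: they are reached
through `round` only.
* `ret b`: stop and return `b`;
* `step n`: `n` elementary local steps of the server;
* `uniform n`: draw a uniformly random element of `{0, ..., n - 1}`;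
* `weighted w`: draw an index `i` with probability `w i / ∑ j, w j`;
* `round I Q`: one round of communication. It sends to the clients, in one non-adaptive batch, a
  request for a random element of the `i`-th set for every `i` in `I`, and the membership query
  whether `x` is in the `i`-th set for every `(x, i)` in `Q`. The random elements come back as a
  list in the order of `I`, and the answers to the queries as a table. -/
inductive Alg (m : ℕ) (U : Type u) (β : Type v) : Type (max u v)
  | ret (b : β) : Alg m U β
  | step (n : ℕ) (next : Alg m U β) : Alg m U β
  | uniform (n : ℕ) [NeZero n] (next : Fin n → Alg m U β) : Alg m U β
  | weighted (w : Fin m → ℝ) (next : Fin m → Alg m U β) : Alg m U β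
  | round (I : List (Fin m)) (Q : List (U × Fin m))
      (next : List U → (U → Fin m → Bool) → Alg m U β) : Alg m U β

/-- The result of one run: the returned value, the running time and the number of rounds. -/
structure Outcome (β : Type v) where
  value : β
  time : ℕ
  rounds : ℕ

/-- Add `t` to the time and `r` to the number of rounds. -/
def Outcome.charge {β : Type v} (t r : ℕ) (o : Outcome β) : Outcome β :=
  ⟨o.value, o.time + t, o.rounds + r⟩

/-- The distribution on `Fin m` with probabilities `w i / ∑ j, w j`. For weights whose positive
parts sum to zero this makes no sense, and the value is then the uniform distribution. -/
noncomputable def weightedIndex {m : ℕ} [NeZero m] (w : Fin m → ℝ) : PMF (Fin m) :=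
  if h : (∑' i, ENNReal.ofReal (w i)) ≠ 0 then
    PMF.normalize (fun i => ENNReal.ofReal (w i)) h
      (by rw [tsum_fintype]; exact ENNReal.sum_ne_top.2 fun _ _ => ENNReal.ofReal_ne_top)
  else PMF.uniformOfFintype (Fin m)

/-- Independent random elements of the sets with the indices in the list. -/
noncomputable def drawAll {m : ℕ} {U : Type u} (gen : Fin m → PMF U) :
    List (Fin m) → PMF (List U)
  | [] => PMF.pure []
  | i :: I => (gen i).bind fun x => (drawAll gen I).map fun xs => x :: xs

/-- The distribution of the outcome of an algorithm that runs with client sets `A` and generators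
`gen`. Every random draw of the server, every request for a random element and every membership
query costs one unit of time. In the answer table of a round, a pair that was not queried has the
value `false`. -/
noncomputable def Alg.exec {m : ℕ} [NeZero m] {U : Type u} [DecidableEq U] {β : Type v}
    (A : Fin m → Finset U) (gen : Fin m → PMF U) : Alg m U β → PMF (Outcome β)
  | .ret b => PMF.pure ⟨b, 0, 0⟩
  | .step n next => (next.exec A gen).map (Outcome.charge n 0)
  | @Alg.uniform _ _ _ n _ next => (PMF.uniformOfFintype (Fin n)).bind fun i =>
      ((next i).exec A gen).map (Outcome.charge 1 0)
  | .weighted w next => (weightedIndex w).bind fun i =>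
      ((next i).exec A gen).map (Outcome.charge 1 0)
  | .round I Q next => (drawAll gen I).bind fun xs =>
      ((next xs fun x i => decide ((x, i) ∈ Q ∧ x ∈ A i)).exec A gen).map
        (Outcome.charge (I.length + Q.length) 1)

/-- Sequential composition. -/
def Alg.bind {m : ℕ} {U : Type u} {β : Type v} {β₂ : Type w} :
    Alg m U β → (β → Alg m U β₂) → Alg m U β₂
  | .ret b, f => f b
  | .step n next, f => .step n (next.bind f)
  | @Alg.uniform _ _ _ n _ next, f => .uniform n fun i => (next i).bind f
  | .weighted q next, f => .weighted q fun i => (next i).bind f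
  | .round I Q next, f => .round I Q fun xs a => (next xs a).bind f

/-- Run an algorithm `n` times in sequence and list the results. -/
def Alg.iterate {m : ℕ} {U : Type u} {β : Type v} (p : Alg m U β) : ℕ → Alg m U (List β)
  | 0 => .ret []
  | n + 1 => p.bind fun b => (p.iterate n).bind fun l => .ret (b :: l)

/-- A uniformly random index of one of the `m` sets. -/
def randomIndex {m : ℕ} [NeZero m] {U : Type u} : Alg m U (Fin m) :=
  .uniform m fun i => .ret i

/-- An index `i` with probability `size i / ∑ j, size j`. The additional local steps pay for a
binary search in a table of the partial sums of the sizes. -/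
def randomSet {m : ℕ} {U : Type u} (size : Fin m → ℝ) : Alg m U (Fin m) :=
  .weighted size fun i => .step (Nat.clog 2 m) (.ret i)

/-- `n` independent uniformly random members of a list (none if the list is empty). -/
def randomSamples {m : ℕ} {U : Type u} : List U → ℕ → Alg m U (List U)
  | [], _ => .ret []
  | x :: l, n => Alg.iterate
      (.uniform (l.length + 1) fun i => .ret ((x :: l).get i)) n

/-- The input parameters of ApproximateUnion apart from the list: the value `f₁ ≥ 8` of the function
that controls the number of rounds, bounds `zmin` and `zmax` for the number of the sets that contain
an element of the union, the failure probability `γ` and the accuracy `ε`. -/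
structure Params where
  f₁ : ℝ
  zmin : ℕ
  zmax : ℕ
  γ : ℝ
  ε : ℝ

namespace Params

variable (p : Params) (m : ℕ)

noncomputable def ε₀ : ℝ := p.ε / 9
noncomputable def ε₁ : ℝ := p.ε₀ / (6 * Real.logb 2 m)
noncomputable def ε₂ : ℝ := p.ε₁ m / 4
noncomputable def ε₃ : ℝ := p.ε₀ / 3
noncomputable def δ : ℝ := p.ε₂ m / 2
noncomputable def γ₂ : ℝ := p.γ / (6 * Real.logb 2 m)

/-- The number of the intervals `[(1 + δ) ^ (i - 1), (1 + δ) ^ i)`, `i ≥ 1`, that meet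
`[zmin, zmax]`. -/
noncomputable def v : ℕ :=
  ⌊Real.log p.zmax / Real.log (1 + p.δ m)⌋₊ - ⌊Real.log p.zmin / Real.log (1 + p.δ m)⌋₊ + 1

noncomputable def f₂ : ℝ :=
  2 * p.v m / p.ε₃ +
    2 * Real.logb 2 ((m : ℝ) / p.zmin) / (p.ε₃ * Real.logb 2 (1 + p.δ m))

noncomputable def f₃ : ℝ := p.f₁ * (6 * Real.log (2 / p.γ₂ m) / p.ε₂ m ^ 2)

noncomputable def f₄ : ℝ :=
  p.f₂ m * Real.logb 2 ((m : ℝ) ^ 2 / p.ε₁ m) / (6 * p.ε₁ m ^ 2) + p.f₃ m / (p.ε₂ m * p.f₁)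

noncomputable def f₅ : ℝ := m * p.f₄ m / p.zmin

noncomputable def γ₃ : ℝ := p.γ₂ m / (2 * p.f₅ m)

noncomputable def f₆ : ℝ := p.f₁ * (24 / p.ε₁ m ^ 2 * Real.log (2 / p.γ₃ m))

end Params

/-- The stages of ApproximateUnion, where `M` is the sum of the approximate sizes and `h₁` the
number of the initial random samples. The state at the beginning of a stage consists of the current
thickness `ct`, the weight `wt` of the samples, the current value of `sum`, and the current
list `R` of samples. The first argument bounds the number of stages. A bounded number of
arithmetic operations costs one step; a pass over a list costs one step for each entry. -/
noncomputable def stages {m : ℕ} [NeZero m] {U : Type u} (p : Params) (M : ℝ) (h₁ : ℕ) :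
    ℕ → (ct wt sum : ℝ) → (R : List U) → Alg m U ℝ
  | 0, _, _, sum, _ => .step 1 (.ret (sum * M))
  | n + 1, ct, wt, sum, R =>
    let s : ℝ := m / ct
    let k : ℕ := ⌈s * p.f₆ m⌉₊
    .step 1 <| (Alg.iterate randomIndex k).bind fun H =>
    .round [] (R ×ˢ H) fun _ answer =>
    let S : U → ℕ := fun x => H.countP (answer x)
    let V : List U := R.filter fun x => ct / (2 * p.f₁ * m) * k ≤ S x
    let rest : List U := R.filter fun x => ¬ ct / (2 * p.f₁ * m) * k ≤ S x
    let newSum : ℝ := sum + wt * (V.map fun x => (k : ℝ) / (S x * m)).sum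
    let newCt : ℝ := ct / p.f₁
    let newS : ℝ := m / newCt
    let h : ℕ := ⌈h₁ / newS⌉₊
    .step (R.length * H.length + R.length + V.length + rest.length + 1) <|
    (if rest.length < h then .ret (rest, 1)
      else (randomSamples rest h).bind fun l => .ret (l, (rest.length : ℝ) / h)).bind
    fun (next : List U × ℝ) =>
    .step 1 <|
    if newCt < p.zmin then .ret (newSum * M)
    else stages p M h₁ n newCt (wt * next.2) newSum next.1

/-- The algorithm ApproximateUnion for a list of `m` sets with the approximate sizes `size`, whose
sum is `M`. First `h₁` random choices from the list are made: each selects the `i`-th set with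
probability `size i / M` and then a random element of this set by its generator; the initial weight
of a sample is `1 / h₁`. The `m` local steps pay for a table of partial sums of the sizes. For
`f₁ ≥ 8`, `zmax ≤ m` and `zmin ≥ 1` the algorithm stops by itself after at most `m` stages, since
the current thickness falls below `zmin`. -/
noncomputable def approximateUnion {m : ℕ} [NeZero m] {U : Type u} (p : Params)
    (size : Fin m → ℝ) (M : ℝ) : Alg m U ℝ :=
  let h₁ : ℕ := ⌈p.f₅ m⌉₊
  .step (m + 1) <| (Alg.iterate (randomSet size) h₁).bind fun I =>
  .round I [] fun R _ =>
  stages p M h₁ m p.zmax (1 / h₁) 0 R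

end SetUnion

namespace SetUnion

universe u v w

open scoped ENNReal

/-! Let T(x) be the number of sets that contain x. The sum of 1/T(x) over all pairs (i, x) with x ∈
A_i counts every element of the union exactly once. Hence, if μ is the mean of 1/T over an initial
sample, μ·M equals the size of the union up to the bias factors of the sizes and the generators
(`le_mean_mul`, `mean_mul_le`). Since 1/T lies in [0, 1] and μ ≥ 1/m, a Chernoff bound shows that h₁
samples give μ accurately once h₁/m is large compared with ε₁⁻² ln(2/γ₂).

The stages evaluate the sum of 1/T over these samples approximately. The quantity that they preserve
is Φ = sum + wt · ∑_{x ∈ R} 1/T(x). At thickness c, about f₆·m/c random indices estimate T(x) within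
a factor 1 ± ε₁ for every x that passes the test, and no x with T(x) ≥ c/8 fails it
(`goodCount_of_iid`). The elements left over have weight above 8/c, so about h₁c/(8m) random ones
among them again have expected total weight at least h₁/m, and the concentration is equally good at
every level (`resample_le`). Counting errors affect only the elements removed and resampling errors
only those kept, so a stage costs Φ a single factor 1 ± 2ε₁, with failure probability at most 2γ₂
(`law_stages`).

The thickness falls by 8 in each stage, so there are at most log₈ m + 1 stages. Together with the
initial sampling this gives the error (1 ± 2ε₁)^(log₈ m + 2), within 1 ± ε, and failure probability
at most γ₂(1 + 2(log₈ m + 1)) ≤ γ.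

The cost bounds hold on every run: the list has at most h₁c/m + 1 entries and is tested against at
most m f₆/c + 1 indices, and c cancels in the main term h₁f₆ of the product. That this is m times a
polynomial in 1/ε, ln(1/γ) and log₂ m follows from closure properties of `PolyDominated`. -/

theorem length_of_mem_support_drawAll {m : ℕ} {U : Type u} {gen : Fin m → PMF U} {I : List (Fin m)} {xs : List U}
    (h : xs ∈ (drawAll gen I).support) : xs.length = I.length := by
  induction I generalizing xs with
  | nil => simp_all [drawAll]
  | cons i I ih =>
    simp only [drawAll, PMF.mem_support_bind_iff, PMF.support_map, Set.mem_image] at h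
    obtain ⟨x, -, ys, hys, rfl⟩ := h
    simp [ih hys]

/-! ### Laws and worst-case costs of algorithms -/

section Semantics

variable {m : ℕ} [NeZero m] {U : Type u} [DecidableEq U] {β : Type v} {β₂ : Type w}
  (A : Fin m → Finset U) (gen : Fin m → PMF U)

theorem Outcome.charge_charge (t r t' r' : ℕ) (o : Outcome β) :
    (o.charge t r).charge t' r' = o.charge (t + t') (r + r') := by
  simp [Outcome.charge, add_assoc]

/-- Charges are additive, so the costs of the first part can be added after the second part has run.
Correctness can then be treated through `Alg.law`, which forgets costs, and costs through
`Alg.Bounded`, which forgets probabilities. -/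
theorem Alg.exec_bind (a : Alg m U β) (f : β → Alg m U β₂) :
    (a.bind f).exec A gen = (a.exec A gen).bind fun o =>
      ((f o.value).exec A gen).map (Outcome.charge o.time o.rounds) := by
  induction a with
  | ret b =>
    simp only [Alg.bind, Alg.exec, PMF.pure_bind]
    exact (PMF.map_id _).symm
  | step n next ih =>
    simp only [Alg.bind, Alg.exec, ih, PMF.map_bind, PMF.bind_map, PMF.map_comp]
    congr 1; funext o; simp only [Function.comp_def, Outcome.charge_charge]
    rfl
  | uniform n next ih =>
    simp only [Alg.bind, Alg.exec, ih, PMF.map_bind, PMF.bind_map, PMF.map_comp, PMF.bind_bind]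
    congr 1
  | weighted q next ih =>
    simp only [Alg.bind, Alg.exec, ih, PMF.map_bind, PMF.bind_map, PMF.map_comp, PMF.bind_bind]
    congr 1
  | round I Q next ih =>
    simp only [Alg.bind, Alg.exec, ih, PMF.map_bind, PMF.bind_map, PMF.map_comp, PMF.bind_bind]
    congr 1; funext i; congr 1; funext o; simp only [Function.comp_def, Outcome.charge_charge]
    rfl

/-- The distribution of the returned value. -/
noncomputable def Alg.law (a : Alg m U β) : PMF β := (a.exec A gen).map Outcome.value

theorem value_comp_charge (t r : ℕ) :
    (Outcome.value ∘ Outcome.charge t r : Outcome β → β) = Outcome.value := rfl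

@[simp]
theorem Alg.law_ret (b : β) : (Alg.ret b : Alg m U β).law A gen = PMF.pure b := by
  simp [Alg.law, Alg.exec, PMF.pure_map]

@[simp]
theorem Alg.law_step (n : ℕ) (a : Alg m U β) : (Alg.step n a).law A gen = a.law A gen := by
  simp [Alg.law, Alg.exec, PMF.map_comp, value_comp_charge]

@[simp]
theorem Alg.law_uniform (n : ℕ) [NeZero n] (f : Fin n → Alg m U β) :
    (Alg.uniform n f).law A gen = (PMF.uniformOfFintype (Fin n)).bind fun i => (f i).law A gen := by
  simp [Alg.law, Alg.exec, PMF.map_comp, PMF.map_bind, value_comp_charge]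

@[simp]
theorem Alg.law_weighted (q : Fin m → ℝ) (f : Fin m → Alg m U β) :
    (Alg.weighted q f).law A gen = (weightedIndex q).bind fun i => (f i).law A gen := by
  simp [Alg.law, Alg.exec, PMF.map_comp, PMF.map_bind, value_comp_charge]

@[simp]
theorem Alg.law_round (I : List (Fin m)) (Q : List (U × Fin m))
    (next : List U → (U → Fin m → Bool) → Alg m U β) :
    (Alg.round I Q next).law A gen = (drawAll gen I).bind fun xs =>
      (next xs fun x i => decide ((x, i) ∈ Q ∧ x ∈ A i)).law A gen := by
  simp only [Alg.law, Alg.exec, PMF.map_comp, PMF.map_bind, value_comp_charge]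

@[simp]
theorem Alg.law_bind (a : Alg m U β) (f : β → Alg m U β₂) :
    (a.bind f).law A gen = (a.law A gen).bind fun b => (f b).law A gen := by
  simp only [Alg.law, Alg.exec_bind, PMF.map_comp, PMF.map_bind, PMF.bind_map, value_comp_charge]
  rfl

/-- Every run takes time at most `t` and at most `r` rounds, and its result satisfies `Q`. -/
def Alg.Bounded (a : Alg m U β) (t r : ℕ) (Q : β → Prop) : Prop :=
  ∀ o ∈ (a.exec A gen).support, o.time ≤ t ∧ o.rounds ≤ r ∧ Q o.value

variable {A gen}

theorem Alg.Bounded.mono {a : Alg m U β} {t r t' r' : ℕ} {Q Q' : β → Prop}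
    (h : a.Bounded A gen t r Q) (ht : t ≤ t') (hr : r ≤ r') (hQ : ∀ b, Q b → Q' b) :
    a.Bounded A gen t' r' Q' := fun o ho =>
  ⟨(h o ho).1.trans ht, (h o ho).2.1.trans hr, hQ _ (h o ho).2.2⟩

theorem Alg.bounded_ret {b : β} {Q : β → Prop} (h : Q b) :
    (Alg.ret b : Alg m U β).Bounded A gen 0 0 Q := by
  intro o ho
  simp only [Alg.exec, PMF.support_pure, Set.mem_singleton_iff] at ho
  subst ho
  exact ⟨le_rfl, le_rfl, h⟩

theorem Alg.Bounded.step {a : Alg m U β} {t r : ℕ} {Q : β → Prop} (h : a.Bounded A gen t r Q)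
    (n : ℕ) : (Alg.step n a).Bounded A gen (t + n) r Q := by
  intro o ho
  simp only [Alg.exec, PMF.support_map, Set.mem_image] at ho
  obtain ⟨o', ho', rfl⟩ := ho
  obtain ⟨h1, h2, h3⟩ := h o' ho'
  exact ⟨Nat.add_le_add_right h1 n, h2, h3⟩

theorem Alg.bounded_uniform {n : ℕ} [NeZero n] {f : Fin n → Alg m U β} {t r : ℕ} {Q : β → Prop}
    (h : ∀ i, (f i).Bounded A gen t r Q) : (Alg.uniform n f).Bounded A gen (t + 1) r Q := by
  intro o ho
  simp only [Alg.exec, PMF.mem_support_bind_iff, PMF.support_map, Set.mem_image] at ho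
  obtain ⟨i, -, o', ho', rfl⟩ := ho
  obtain ⟨h1, h2, h3⟩ := h i o' ho'
  exact ⟨Nat.add_le_add_right h1 1, h2, h3⟩

theorem Alg.bounded_weighted {q : Fin m → ℝ} {f : Fin m → Alg m U β} {t r : ℕ} {Q : β → Prop}
    (h : ∀ i, (f i).Bounded A gen t r Q) : (Alg.weighted q f).Bounded A gen (t + 1) r Q := by
  intro o ho
  simp only [Alg.exec, PMF.mem_support_bind_iff, PMF.support_map, Set.mem_image] at ho
  obtain ⟨i, -, o', ho', rfl⟩ := ho
  obtain ⟨h1, h2, h3⟩ := h i o' ho'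
  exact ⟨Nat.add_le_add_right h1 1, h2, h3⟩

theorem Alg.bounded_round {I : List (Fin m)} {Q : List (U × Fin m)}
    {next : List U → (U → Fin m → Bool) → Alg m U β} {t r : ℕ} {P : β → Prop}
    (h : ∀ xs a, xs.length = I.length → (next xs a).Bounded A gen t r P) :
    (Alg.round I Q next).Bounded A gen (t + (I.length + Q.length)) (r + 1) P := by
  intro o ho
  simp only [Alg.exec, PMF.mem_support_bind_iff, PMF.support_map, Set.mem_image] at ho
  obtain ⟨xs, hxs, o', ho', rfl⟩ := ho
  obtain ⟨h1, h2, h3⟩ := h xs _ (length_of_mem_support_drawAll hxs) o' ho'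
  exact ⟨Nat.add_le_add_right h1 _, Nat.add_le_add_right h2 1, h3⟩

theorem Alg.Bounded.bind {a : Alg m U β} {f : β → Alg m U β₂} {t r t' r' : ℕ} {Q : β → Prop}
    {Q' : β₂ → Prop} (h : a.Bounded A gen t r Q)
    (h' : ∀ b, Q b → (f b).Bounded A gen t' r' Q') :
    (a.bind f).Bounded A gen (t + t') (r + r') Q' := by
  intro o ho
  simp only [Alg.exec_bind, PMF.mem_support_bind_iff, PMF.support_map, Set.mem_image] at ho
  obtain ⟨o₁, ho₁, o₂, ho₂, rfl⟩ := ho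
  obtain ⟨h1, h2, h3⟩ := h o₁ ho₁
  obtain ⟨h4, h5, h6⟩ := h' _ h3 o₂ ho₂
  exact ⟨by simp only [Outcome.charge]; omega, by simp only [Outcome.charge]; omega, h6⟩

theorem Alg.Bounded.iterate {a : Alg m U β} {t : ℕ} (h : a.Bounded A gen t 0 fun _ => True)
    (n : ℕ) : (a.iterate n).Bounded A gen (n * t) 0 fun l => l.length = n := by
  induction n with
  | zero => exact (Alg.bounded_ret (Q := fun l => l.length = 0) rfl).mono (by simp) le_rfl fun _ h => h
  | succ n ih =>
    refine (h.bind (t' := n * t) (r' := 0) (Q' := fun l => l.length = n + 1) fun b _ => ?_).mono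
      (by rw [add_mul, one_mul, add_comm]) le_rfl fun _ h => h
    exact (ih.bind (t' := 0) (r' := 0) fun l hl => Alg.bounded_ret (by simp [hl])).mono
      le_rfl le_rfl fun _ h => h

end Semantics

/-- The distribution of a list of `n` independent samples. -/
noncomputable def iid {α : Type u} (p : PMF α) : ℕ → PMF (List α)
  | 0 => PMF.pure []
  | n + 1 => p.bind fun b => (iid p n).bind fun l => PMF.pure (b :: l)

theorem Alg.law_iterate {m : ℕ} [NeZero m] {U : Type u} [DecidableEq U] {β : Type v}
    (A : Fin m → Finset U) (gen : Fin m → PMF U) (a : Alg m U β) (n : ℕ) :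
    (a.iterate n).law A gen = iid (a.law A gen) n := by
  induction n with
  | zero => simp [Alg.iterate, iid]
  | succ n ih => simp [Alg.iterate, iid, ih]

/-- The algorithm fixes all indices before the round and receives all elements in it. The draws are
independent, so they may be reordered to pair each index with its element, which turns the batch
into independent samples of the mixture. -/
theorem iid_bind_drawAll {m : ℕ} {U : Type u} (gen : Fin m → PMF U) (p : PMF (Fin m)) (n : ℕ) :
    (iid p n).bind (drawAll gen) = iid (p.bind gen) n := by
  induction n with
  | zero => simp [iid, drawAll]
  | succ n ih =>
    simp only [iid, ← ih, PMF.bind_bind, PMF.pure_bind, drawAll]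
    congr 1; funext i
    rw [PMF.bind_comm]
    rfl

theorem length_of_mem_support_iid {α : Type u} {p : PMF α} {n : ℕ} {l : List α}
    (h : l ∈ (iid p n).support) : l.length = n := by
  induction n generalizing l with
  | zero => simp_all [iid]
  | succ n ih =>
    simp only [iid, PMF.mem_support_bind_iff, PMF.support_pure, Set.mem_singleton_iff] at h
    obtain ⟨x, -, ys, hys, rfl⟩ := h
    simp [ih hys]

theorem mem_support_of_mem_iid {α : Type u} {p : PMF α} {n : ℕ} {l : List α}
    (h : l ∈ (iid p n).support) {x : α} (hx : x ∈ l) : x ∈ p.support := by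
  induction n generalizing l with
  | zero => simp_all [iid]
  | succ n ih =>
    simp only [iid, PMF.mem_support_bind_iff, PMF.support_pure, Set.mem_singleton_iff] at h
    obtain ⟨y, hy, ys, hys, rfl⟩ := h
    rcases List.mem_cons.1 hx with rfl | hx
    · exact hy
    · exact ih hys hx

/-! ### Expectations and Chernoff bounds for independent samples -/

section Concentration

variable {α : Type u} {β : Type v}

/-- The union bound for sequential randomness: either the first part already fails, or the second
part fails after a good start. All failure probabilities of the algorithm are added up in this way.
-/
theorem toOuterMeasure_bind_le (p : PMF α) (f : α → PMF β) (E : Set α) (B : Set β) (c : ℝ≥0∞)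
    (h : ∀ a ∈ p.support, a ∉ E → (f a).toOuterMeasure B ≤ c) :
    (p.bind f).toOuterMeasure B ≤ p.toOuterMeasure E + c := by
  classical
  rw [PMF.toOuterMeasure_bind_apply, PMF.toOuterMeasure_apply]
  have hc : c = ∑' a, p a * c := by rw [ENNReal.tsum_mul_right, p.tsum_coe, one_mul]
  rw [hc, ← ENNReal.tsum_add]
  refine ENNReal.tsum_le_tsum fun a => ?_
  by_cases ha : p a = 0
  · simp [ha]
  by_cases hE : a ∈ E
  · rw [Set.indicator_of_mem hE]
    have h1 : (f a).toOuterMeasure B ≤ 1 := by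
      rw [← (f a).toOuterMeasure_apply_eq_one_iff (s := Set.univ) |>.2 (Set.subset_univ _)]
      exact MeasureTheory.measure_mono (Set.subset_univ _)
    exact (mul_le_of_le_one_right' h1).trans le_self_add
  · rw [Set.indicator_of_notMem hE, zero_add]
    gcongr
    exact h a ((p.mem_support_iff a).2 ha) hE

theorem toOuterMeasure_le_of_support {p : PMF α} {E : Set α} (h : ∀ a ∈ p.support, a ∉ E) :
    p.toOuterMeasure E = 0 := by
  rw [PMF.toOuterMeasure_apply_eq_zero_iff, Set.disjoint_left]
  exact h

/-- The expectation of a nonnegative function. -/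
noncomputable def expect (p : PMF α) (g : α → ℝ≥0∞) : ℝ≥0∞ := ∑' a, p a * g a

theorem expect_bind (p : PMF α) (f : α → PMF β) (g : β → ℝ≥0∞) :
    expect (p.bind f) g = expect p fun a => expect (f a) g := by
  simp only [expect, PMF.bind_apply, ← ENNReal.tsum_mul_left, ← ENNReal.tsum_mul_right]
  rw [ENNReal.tsum_comm]
  simp only [mul_assoc]

theorem expect_pure (a : α) (g : α → ℝ≥0∞) : expect (PMF.pure a) g = g a := by
  classical
  rw [expect, tsum_eq_single a]
  · simp
  · intro b hb; simp [hb]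

theorem expect_map (p : PMF α) (f : α → β) (g : β → ℝ≥0∞) :
    expect (p.map f) g = expect p fun a => g (f a) := by
  rw [PMF.map, expect_bind]
  simp [expect_pure]

theorem expect_const_mul (p : PMF α) (c : ℝ≥0∞) (g : α → ℝ≥0∞) :
    expect p (fun a => c * g a) = c * expect p g := by
  simp only [expect, ← ENNReal.tsum_mul_left, mul_left_comm]

theorem expect_add (p : PMF α) (f g : α → ℝ≥0∞) :
    expect p (fun a => f a + g a) = expect p f + expect p g := by
  simp only [expect, mul_add, ENNReal.tsum_add]

theorem expect_one (p : PMF α) : expect p (fun _ => 1) = 1 := by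
  simp [expect, p.tsum_coe]

theorem expect_mono (p : PMF α) {f g : α → ℝ≥0∞} (h : ∀ a, f a ≤ g a) :
    expect p f ≤ expect p g :=
  ENNReal.tsum_le_tsum fun a => by gcongr; exact h a

theorem expect_uniform {n : ℕ} [NeZero n] (g : Fin n → ℝ) (hg : ∀ i, 0 ≤ g i) :
    expect (PMF.uniformOfFintype (Fin n)) (fun i => ENNReal.ofReal (g i)) =
      ENNReal.ofReal ((∑ i, g i) / n) := by
  have hn : (0 : ℝ) < n := Nat.cast_pos.2 (NeZero.pos n)
  rw [expect, tsum_fintype]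
  simp only [PMF.uniformOfFintype_apply, Fintype.card_fin]
  rw [← Finset.mul_sum, div_eq_inv_mul, ENNReal.ofReal_mul (by positivity),
    ENNReal.ofReal_inv_of_pos hn, ENNReal.ofReal_natCast,
    ENNReal.ofReal_sum_of_nonneg fun i _ => hg i]

theorem expect_iid_prod (p : PMF α) (g : α → ℝ≥0∞) (n : ℕ) :
    expect (iid p n) (fun l => (l.map g).prod) = expect p g ^ n := by
  induction n with
  | zero => simp [iid, expect_pure]
  | succ n ih =>
    simp only [iid, expect_bind, expect_pure, List.map_cons, List.prod_cons, expect_const_mul, ih]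
    simp only [mul_comm (g _), expect_const_mul]
    rw [pow_succ]

theorem toOuterMeasure_le_expect (p : PMF α) (E : Set α) (g : α → ℝ≥0∞) (h : ∀ a ∈ E, 1 ≤ g a) :
    p.toOuterMeasure E ≤ expect p g := by
  rw [PMF.toOuterMeasure_apply]
  refine ENNReal.tsum_le_tsum fun a => ?_
  by_cases ha : a ∈ E
  · rw [Set.indicator_of_mem ha]
    exact le_mul_of_one_le_right' (h a ha)
  · simp [ha]

/-- Markov's inequality for the exponential of the sum, whose expectation factors by independence.
No sign is required of `f`, so both tails follow by scaling with a positive or a negative factor. -/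
theorem toOuterMeasure_iid_le (p : PMF α) (f : α → ℝ) (n : ℕ) (s c : ℝ)
    (hc : expect p (fun a => ENNReal.ofReal (Real.exp (f a))) ≤ ENNReal.ofReal (Real.exp c)) :
    (iid p n).toOuterMeasure {l | s ≤ (l.map f).sum} ≤ ENNReal.ofReal (Real.exp (n * c - s)) := by
  have key : ∀ l : List α, ENNReal.ofReal (Real.exp ((l.map f).sum - s)) =
      ENNReal.ofReal (Real.exp (-s)) *
        (l.map fun a => ENNReal.ofReal (Real.exp (f a))).prod := by
    intro l
    rw [sub_eq_neg_add, Real.exp_add, ENNReal.ofReal_mul (Real.exp_pos _).le]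
    congr 1
    induction l with
    | nil => simp
    | cons a l ih =>
      simp only [List.map_cons, List.sum_cons, List.prod_cons, ← ih]
      rw [Real.exp_add, ENNReal.ofReal_mul (Real.exp_pos _).le]
  refine (toOuterMeasure_le_expect _ _
    (fun l => ENNReal.ofReal (Real.exp ((l.map f).sum - s))) fun l hl => ?_).trans ?_
  · rw [← ENNReal.ofReal_one]
    exact ENNReal.ofReal_le_ofReal (Real.one_le_exp (sub_nonneg.2 hl))
  · simp only [key]
    rw [expect_const_mul, expect_iid_prod]
    calc _ ≤ ENNReal.ofReal (Real.exp (-s)) * ENNReal.ofReal (Real.exp c) ^ n := by gcongr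
      _ = _ := by
        rw [← ENNReal.ofReal_pow (Real.exp_pos _).le, ← Real.exp_nat_mul,
          ← ENNReal.ofReal_mul (Real.exp_pos _).le, ← Real.exp_add, sub_eq_neg_add]

theorem exp_sub_one_le {t : ℝ} (ht : |t| ≤ 1) : Real.exp t - 1 ≤ t + t ^ 2 := by
  have := Real.abs_exp_sub_one_sub_id_le ht
  linarith [(abs_le.1 this).2]

theorem exp_mul_le {t x : ℝ} (hx : x ∈ Set.Icc (0 : ℝ) 1) :
    Real.exp (t * x) ≤ 1 + (Real.exp t - 1) * x := by
  have := convexOn_exp.2 (Set.mem_univ (0 : ℝ)) (Set.mem_univ t) (sub_nonneg.2 hx.2) hx.1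
    (by ring)
  simp only [smul_eq_mul, mul_zero, zero_add, Real.exp_zero, mul_one] at this
  rw [mul_comm t x]
  linarith

theorem chernoff_upper (p : PMF α) (f : α → ℝ) (hf : ∀ a, f a ∈ Set.Icc (0 : ℝ) 1)
    {μ η : ℝ} (hμ₀ : 0 ≤ μ) (hη₀ : 0 ≤ η) (hη : η ≤ 1)
    (hμ : expect p (fun a => ENNReal.ofReal (f a)) ≤ ENNReal.ofReal μ) (n : ℕ) :
    (iid p n).toOuterMeasure {l | (1 + η) * (n * μ) ≤ (l.map f).sum} ≤
      ENNReal.ofReal (Real.exp (-(η ^ 2 * (n * μ) / 4))) := by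
  rcases hη₀.eq_or_lt with rfl | hpos
  · simp only [ne_eq, OfNat.ofNat_ne_zero, not_false_eq_true, zero_pow, zero_mul, zero_div,
      neg_zero, Real.exp_zero, ENNReal.ofReal_one]
    rw [← (iid p n).toOuterMeasure_apply_eq_one_iff (s := Set.univ) |>.2 (Set.subset_univ _)]
    exact MeasureTheory.measure_mono (Set.subset_univ _)
  -- The exponent obtained is nμ((t + t²) − t(1 + η)) = nμ(t² − tη); this t minimizes it, with the
  -- value −η²nμ/4.
  set t : ℝ := η / 2 with ht
  have ht0 : 0 < t := by positivity
  have het : 0 ≤ Real.exp t - 1 := by linarith [Real.add_one_le_exp t]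
  have h1 : expect p (fun a => ENNReal.ofReal (Real.exp (t * f a))) ≤
      ENNReal.ofReal (Real.exp ((t + t ^ 2) * μ)) := by
    calc _ ≤ expect p (fun a => 1 + ENNReal.ofReal (Real.exp t - 1) * ENNReal.ofReal (f a)) := by
          refine expect_mono p fun a => ?_
          rw [← ENNReal.ofReal_one, ← ENNReal.ofReal_mul het,
            ← ENNReal.ofReal_add zero_le_one (mul_nonneg het (hf a).1)]
          exact ENNReal.ofReal_le_ofReal (exp_mul_le (hf a))
      _ ≤ 1 + ENNReal.ofReal (Real.exp t - 1) * ENNReal.ofReal μ := by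
          rw [expect_add, expect_one, expect_const_mul]
          gcongr
      _ ≤ _ := by
          rw [← ENNReal.ofReal_one, ← ENNReal.ofReal_mul het,
            ← ENNReal.ofReal_add zero_le_one (mul_nonneg het hμ₀)]
          refine ENNReal.ofReal_le_ofReal ?_
          have := exp_sub_one_le (t := t) (by rw [abs_of_pos ht0]; linarith)
          have h2 := Real.add_one_le_exp ((t + t ^ 2) * μ)
          nlinarith [mul_le_mul_of_nonneg_right this hμ₀]
  have h2 := toOuterMeasure_iid_le p (fun a => t * f a) n (t * ((1 + η) * (n * μ))) _ h1
  convert h2 using 2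
  · ext l
    simp only [Set.mem_ofPred_eq, List.sum_map_mul_left]
    exact (mul_le_mul_iff_right₀ ht0).symm
  · congr 1
    rw [ht]; ring

theorem chernoff_lower (p : PMF α) (f : α → ℝ) (hf : ∀ a, f a ∈ Set.Icc (0 : ℝ) 1)
    {μ η : ℝ} (hμ₀ : 0 ≤ μ) (hη₀ : 0 ≤ η) (hη : η ≤ 1)
    (hμ : ENNReal.ofReal μ ≤ expect p (fun a => ENNReal.ofReal (f a))) (n : ℕ) :
    (iid p n).toOuterMeasure {l | (l.map f).sum ≤ (1 - η) * (n * μ)} ≤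
      ENNReal.ofReal (Real.exp (-(η ^ 2 * (n * μ) / 4))) := by
  rcases hη₀.eq_or_lt with rfl | hpos
  · simp only [ne_eq, OfNat.ofNat_ne_zero, not_false_eq_true, zero_pow, zero_mul, zero_div,
      neg_zero, Real.exp_zero, ENNReal.ofReal_one]
    rw [← (iid p n).toOuterMeasure_apply_eq_one_iff (s := Set.univ) |>.2 (Set.subset_univ _)]
    exact MeasureTheory.measure_mono (Set.subset_univ _)
  set t : ℝ := η / 2 with ht
  have ht0 : 0 < t := by positivity
  have het : 0 ≤ 1 - Real.exp (-t) := by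
    linarith [Real.exp_le_one_iff.2 (neg_nonpos.2 ht0.le)]
  have h1 : expect p (fun a => ENNReal.ofReal (Real.exp (-t * f a))) ≤
      ENNReal.ofReal (Real.exp ((-t + t ^ 2) * μ)) := by
    -- The coefficient of the mean in the convexity bound is negative here, so that term is moved to
    -- the left, where everything is nonnegative and additivity of `expect` applies.
    have h3 : expect p (fun a => ENNReal.ofReal (Real.exp (-t * f a))) +
        ENNReal.ofReal (1 - Real.exp (-t)) * ENNReal.ofReal μ ≤ 1 := by
      calc _ ≤ expect p (fun a => ENNReal.ofReal (Real.exp (-t * f a))) +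
            ENNReal.ofReal (1 - Real.exp (-t)) * expect p (fun a => ENNReal.ofReal (f a)) := by
              gcongr
        _ = expect p (fun a => ENNReal.ofReal (Real.exp (-t * f a)) +
            ENNReal.ofReal (1 - Real.exp (-t)) * ENNReal.ofReal (f a)) := by
              rw [expect_add, expect_const_mul]
        _ ≤ expect p (fun _ => 1) := by
              refine expect_mono p fun a => ?_
              rw [← ENNReal.ofReal_one, ← ENNReal.ofReal_mul het,
                ← ENNReal.ofReal_add (Real.exp_pos _).le (mul_nonneg het (hf a).1)]
              refine ENNReal.ofReal_le_ofReal ?_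
              linarith [exp_mul_le (t := -t) (hf a)]
        _ = 1 := expect_one p
    have h4 := ENNReal.le_sub_of_add_le_right
      (ENNReal.mul_ne_top ENNReal.ofReal_ne_top ENNReal.ofReal_ne_top) h3
    refine h4.trans ?_
    rw [← ENNReal.ofReal_one, ← ENNReal.ofReal_mul het,
      ← ENNReal.ofReal_sub _ (mul_nonneg het hμ₀)]
    refine ENNReal.ofReal_le_ofReal ?_
    have := exp_sub_one_le (t := -t) (by rw [abs_neg, abs_of_pos ht0]; linarith)
    have h2 := Real.add_one_le_exp ((-t + t ^ 2) * μ)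
    nlinarith [mul_le_mul_of_nonneg_right this hμ₀]
  have h2 := toOuterMeasure_iid_le p (fun a => -t * f a) n (-t * ((1 - η) * (n * μ))) _ h1
  convert h2 using 2
  · ext l
    simp only [Set.mem_ofPred_eq, List.sum_map_mul_left]
    rw [neg_mul, neg_mul, neg_le_neg_iff]
    exact (mul_le_mul_iff_right₀ ht0).symm
  · congr 1
    rw [ht]; ring

/-- The sum of independent samples with values in `[0, 1]` is close to its expectation. -/
theorem chernoff (p : PMF α) (f : α → ℝ) (hf : ∀ a, f a ∈ Set.Icc (0 : ℝ) 1)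
    {μ η : ℝ} (hμ₀ : 0 ≤ μ) (hη₀ : 0 ≤ η) (hη : η ≤ 1)
    (hμ : expect p (fun a => ENNReal.ofReal (f a)) = ENNReal.ofReal μ) (n : ℕ) {c : ℝ} (hc : 0 < c)
    (h : Real.log (2 / c) ≤ η ^ 2 * (n * μ) / 4) :
    (iid p n).toOuterMeasure {l | ¬ ((1 - η) * (n * μ) ≤ (l.map f).sum ∧
      (l.map f).sum ≤ (1 + η) * (n * μ))} ≤ ENNReal.ofReal c := by
  have hexp : Real.exp (-(η ^ 2 * (n * μ) / 4)) ≤ c / 2 := by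
    calc _ ≤ Real.exp (-Real.log (2 / c)) := Real.exp_le_exp.2 (neg_le_neg h)
      _ = c / 2 := by rw [Real.exp_neg, Real.exp_log (by positivity), inv_div]
  calc _ ≤ (iid p n).toOuterMeasure ({l | (l.map f).sum ≤ (1 - η) * (n * μ)} ∪
        {l | (1 + η) * (n * μ) ≤ (l.map f).sum}) := by
          refine MeasureTheory.measure_mono fun l hl => ?_
          simp only [Set.mem_ofPred_eq, not_and_or, not_le] at hl
          exact hl.imp le_of_lt le_of_lt
    _ ≤ ENNReal.ofReal (c / 2) + ENNReal.ofReal (c / 2) := by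
          refine (MeasureTheory.measure_union_le _ _).trans (add_le_add ?_ ?_)
          · exact (chernoff_lower p f hf hμ₀ hη₀ hη hμ.ge n).trans
              (ENNReal.ofReal_le_ofReal hexp)
          · exact (chernoff_upper p f hf hμ₀ hη₀ hη hμ.le n).trans
              (ENNReal.ofReal_le_ofReal hexp)
    _ = ENNReal.ofReal c := by
          rw [← ENNReal.ofReal_add (by positivity) (by positivity), add_halves]

end Concentration

/-! ### One stage: thickness tests and resampling -/

section Stage

variable {m : ℕ} {U : Type u} [DecidableEq U]

/-- The number of the sets that contain `x`. -/
def thickness (A : Fin m → Finset U) (x : U) : ℕ := (Finset.univ.filter fun i => x ∈ A i).card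

/-- The weight of `x` in the sum that ApproximateUnion estimates. -/
noncomputable def invThickness (A : Fin m → Finset U) (x : U) : ℝ := 1 / (thickness A x : ℝ)

theorem thickness_le (A : Fin m → Finset U) (x : U) : thickness A x ≤ m := by
  simpa [thickness] using Finset.card_filter_le (Finset.univ : Finset (Fin m)) fun i => x ∈ A i

theorem invThickness_mem (A : Fin m → Finset U) (x : U) :
    invThickness A x ∈ Set.Icc (0 : ℝ) 1 := by
  unfold invThickness
  refine ⟨by positivity, ?_⟩
  rcases Nat.eq_zero_or_pos (thickness A x) with h | h
  · simp [h]
  · exact (div_le_one (by positivity)).2 (by exact_mod_cast h)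

theorem sum_invThickness_nonneg (A : Fin m → Finset U) (R : List U) :
    0 ≤ (R.map (invThickness A)).sum :=
  List.sum_nonneg fun y hy => by
    obtain ⟨x, -, rfl⟩ := List.mem_map.1 hy
    exact (invThickness_mem A x).1

/-- The number of indices in the list, with multiplicity, of sets that contain `x`. -/
def hits (A : Fin m → Finset U) (H : List (Fin m)) (x : U) : ℕ := H.countP fun i => x ∈ A i

theorem hits_eq_sum (A : Fin m → Finset U) (H : List (Fin m)) (x : U) :
    (hits A H x : ℝ) = (H.map fun i => if x ∈ A i then (1 : ℝ) else 0).sum := by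
  induction H with
  | nil => simp [hits]
  | cons i H ih =>
    simp only [hits, List.countP_cons, List.map_cons, List.sum_cons] at ih ⊢
    rw [← ih]
    split_ifs <;> simp_all [add_comm]

/-- The count `S` of an element of thickness `T` in a sample of `k` indices allows to decide
whether `T` is large, and to estimate `T` in this case. -/
def GoodCount (m : ℕ) (e c : ℝ) (k : ℕ) (T : ℕ) (S : ℕ) : Prop :=
  (c / 8 ≤ T → c / (2 * 8 * m) * k ≤ S) ∧
    (c / (2 * 8 * m) * k ≤ S → (1 - e) * (k * (T / m)) ≤ S ∧ (S : ℝ) ≤ (1 + e) * (k * (T / m)))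

/-- The expected count is kT/m. If T ≥ c/32, it is large enough for a two-sided Chernoff bound with
relative error e, and the test is passed for T ≥ c/8 because 1 − e ≥ 1/2. If T < c/32, the count
would have to reach twice an upper bound for its mean to pass the test, so with high probability
both implications hold vacuously. -/
theorem goodCount_of_iid [NeZero m] (A : Fin m → Finset U) (x : U) {e c g : ℝ} {k : ℕ} (he₀ : 0 < e)
    (he : e ≤ 1 / 2) (hc : 0 < c) (hg₀ : 0 < g) (hg : g ≤ 1)
    (hk : m / c * (8 * (24 / e ^ 2 * Real.log (2 / g))) ≤ k) :
    (iid (PMF.uniformOfFintype (Fin m)) k).toOuterMeasure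
      {H | ¬ GoodCount m e c k (thickness A x) (hits A H x)} ≤ ENNReal.ofReal g := by
  have hm : (0 : ℝ) < m := Nat.cast_pos.2 (NeZero.pos m)
  have hlog : 0 ≤ Real.log (2 / g) := Real.log_nonneg ((one_le_div hg₀).2 (by linarith))
  have hf : ∀ i : Fin m, (if x ∈ A i then (1 : ℝ) else 0) ∈ Set.Icc (0 : ℝ) 1 := by
    intro i; split_ifs <;> simp
  have hexp : expect (PMF.uniformOfFintype (Fin m))
      (fun i => ENNReal.ofReal (if x ∈ A i then (1 : ℝ) else 0)) =
      ENNReal.ofReal (thickness A x / m) := by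
    rw [expect_uniform _ fun i => (hf i).1]
    simp [thickness]
  set L := Real.log (2 / g) with hL
  -- Here 192 = 8 · 24. Below, only 128 = 4 · 32 is needed: 4 from the Chernoff exponent and 32 from
  -- the case distinction.
  have hk' : 192 * L ≤ e ^ 2 * (k * (c / m)) := by
    have h1 := mul_le_mul_of_nonneg_right hk (show 0 ≤ e ^ 2 * (c / m) by positivity)
    calc 192 * L = m / c * (8 * (24 / e ^ 2 * L)) * (e ^ 2 * (c / m)) := by
          field_simp; ring
      _ ≤ _ := h1.trans_eq (by ring)
  by_cases hT : c / 32 ≤ thickness A x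
  · refine le_trans (MeasureTheory.measure_mono ?_) (chernoff (PMF.uniformOfFintype (Fin m)) _ hf
      (μ := thickness A x / m) (η := e) (by positivity) he₀.le (by linarith) hexp k hg₀ ?_)
    · intro H hH
      simp only [Set.mem_ofPred_eq, ← hits_eq_sum] at hH ⊢
      contrapose! hH
      refine ⟨fun h => le_trans ?_ hH.1, fun _ => hH⟩
      have h2 : (1 / 2 : ℝ) * (k * ((c / 8) / m)) ≤ (1 - e) * (k * (thickness A x / m)) := by
        gcongr <;> linarith
      refine le_trans (le_of_eq ?_) h2
      ring
    · have h2 : e ^ 2 * (k * ((c / 32) / m)) ≤ e ^ 2 * (k * (thickness A x / m)) := by gcongr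
      have h3 : e ^ 2 * (k * ((c / 32) / m)) = e ^ 2 * (k * (c / m)) / 32 := by ring
      linarith
  · push Not at hT
    -- With η = 1 the bound excludes counts of at least 2 · kc/(32m), which is exactly the threshold
    -- kc/(16m) of the test.
    have h1 := chernoff_upper (PMF.uniformOfFintype (Fin m)) _ hf
      (μ := c / (32 * m)) (η := 1) (by positivity) zero_le_one le_rfl (by
        rw [hexp]; refine ENNReal.ofReal_le_ofReal ?_
        rw [div_le_div_iff₀ hm (by positivity)]
        nlinarith) k
    refine le_trans (MeasureTheory.measure_mono ?_) (h1.trans (ENNReal.ofReal_le_ofReal ?_))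
    · intro H hH
      simp only [Set.mem_ofPred_eq, ← hits_eq_sum] at hH ⊢
      contrapose! hH
      have h5 : (hits A H x : ℝ) < c / (2 * 8 * m) * k := by
        refine hH.trans_eq ?_
        field_simp; ring
      exact ⟨fun h => absurd h (by linarith), fun h => absurd h (not_le.2 h5)⟩
    · have h2 : L ≤ 1 ^ 2 * (k * (c / (32 * m))) / 4 := by
        have h3 : e ^ 2 * (k * (c / m)) ≤ 1 * (k * (c / m)) := by
          gcongr; nlinarith
        have h4 : (1 : ℝ) ^ 2 * (k * (c / (32 * m))) / 4 = (k * (c / m)) / 128 := by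
          field_simp; ring
        linarith
      calc _ ≤ Real.exp (-L) := Real.exp_le_exp.2 (neg_le_neg h2)
        _ = g / 2 := by rw [Real.exp_neg, hL, Real.exp_log (by positivity), inv_div]
        _ ≤ g := by linarith

theorem toOuterMeasure_exists_mem_le {α : Type v} {β : Type w} (p : PMF α) (Q : α → β → Prop)
    (c : ℝ≥0∞) (R : List β) (h : ∀ x ∈ R, p.toOuterMeasure {a | Q a x} ≤ c) :
    p.toOuterMeasure {a | ∃ x ∈ R, Q a x} ≤ R.length * c := by
  induction R with
  | nil => simp
  | cons x R ih =>
    have : {a | ∃ y ∈ x :: R, Q a y} = {a | Q a x} ∪ {a | ∃ y ∈ R, Q a y} := by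
      ext a; simp
    rw [this]
    refine (MeasureTheory.measure_union_le _ _).trans ?_
    rw [List.length_cons, Nat.cast_add, Nat.cast_one, add_mul, one_mul, add_comm]
    exact add_le_add (ih fun y hy => h y (List.mem_cons_of_mem _ hy)) (h x List.mem_cons_self)

/-- The estimate of the thickness of an element that passes the test. -/
theorem GoodCount.estimate [NeZero m] {e c : ℝ} {k T S : ℕ} (h : GoodCount m e c k T S)
    (hS : c / (2 * 8 * m) * k ≤ S) (hT : 1 ≤ T) (hk : 0 < k) (he₀ : 0 < e) (he : e ≤ 1 / 2) :
    (1 - 2 * e) * (1 / (T : ℝ)) ≤ k / (S * m) ∧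
      (k : ℝ) / (S * m) ≤ (1 + 2 * e) * (1 / (T : ℝ)) := by
  have hm : (0 : ℝ) < m := Nat.cast_pos.2 (NeZero.pos m)
  have hk' : (0 : ℝ) < k := Nat.cast_pos.2 hk
  have hT' : (0 : ℝ) < T := Nat.cast_pos.2 hT
  obtain ⟨h1, h2⟩ := h.2 hS
  have h3 : 0 < (1 - e) * (k * (T / m)) := mul_pos (by linarith) (by positivity)
  have hS' : (0 : ℝ) < S := h3.trans_le h1
  have e1 : (1 - e) * (k * T) ≤ S * m := by
    have := mul_le_mul_of_nonneg_right h1 hm.le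
    calc _ = (1 - e) * (k * (T / m)) * m := by field_simp
      _ ≤ _ := this
  have e2 : S * m ≤ (1 + e) * (k * T) := by
    have := mul_le_mul_of_nonneg_right h2 hm.le
    calc _ ≤ (1 + e) * (k * (T / m)) * m := this
      _ = _ := by field_simp
  have hkT : 0 < (k : ℝ) * T := by positivity
  rw [mul_one_div, mul_one_div, div_le_div_iff₀ hT' (by positivity),
    div_le_div_iff₀ (by positivity) hT']
  constructor
  · rcases le_or_gt 0 (1 - 2 * e) with h0 | h0
    · calc _ ≤ (1 - 2 * e) * ((1 + e) * (k * T)) := by gcongr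
        _ ≤ k * T := by nlinarith [mul_pos he₀ hkT, mul_pos (mul_pos he₀ he₀) hkT]
    · nlinarith [mul_pos hS' hm]
  · calc (k : ℝ) * T ≤ (1 + 2 * e) * ((1 - e) * (k * T)) := by
          nlinarith [mul_nonneg (mul_nonneg he₀.le (show 0 ≤ 1 - 2 * e by linarith)) hkT.le]
      _ ≤ _ := by gcongr

theorem sum_map_mem_of_forall {α : Type v} (V : List α) (f g : α → ℝ) (a b : ℝ)
    (h : ∀ x ∈ V, a * f x ≤ g x ∧ g x ≤ b * f x) :
    a * (V.map f).sum ≤ (V.map g).sum ∧ (V.map g).sum ≤ b * (V.map f).sum := by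
  rw [← List.sum_map_mul_left, ← List.sum_map_mul_left]
  exact ⟨List.sum_le_sum fun x hx => (h x hx).1, List.sum_le_sum fun x hx => (h x hx).2⟩

theorem sum_map_filter_add {α : Type v} (R : List α) (P : α → Prop) [DecidablePred P] (f : α → ℝ) :
    ((R.filter fun x => P x).map f).sum + ((R.filter fun x => ¬ P x).map f).sum =
      (R.map f).sum := by
  induction R with
  | nil => simp
  | cons x R ih =>
    by_cases hx : P x <;> simp [hx, ← ih] <;> ring

/-- The uniform distribution on positions of the list, pushed forward to its entries, so that
repeated entries count with multiplicity. One distribution serves for every number of samples. -/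
theorem law_randomSamples [NeZero m] (A : Fin m → Finset U) (gen : Fin m → PMF U) {R : List U}
    (hR : R ≠ []) (f : U → ℝ) (hf : ∀ x, 0 ≤ f x) :
    ∃ p : PMF U, (∀ n, (randomSamples R n : Alg m U (List U)).law A gen = iid p n) ∧
      (∀ x ∈ p.support, x ∈ R) ∧
      expect p (fun x => ENNReal.ofReal (f x)) = ENNReal.ofReal ((R.map f).sum / R.length) := by
  cases R with
  | nil => exact absurd rfl hR
  | cons x l =>
    refine ⟨(PMF.uniformOfFintype (Fin (l.length + 1))).map fun i => (x :: l).get i,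
      fun n => ?_, fun y hy => ?_, ?_⟩
    · simp only [randomSamples, Alg.law_iterate, Alg.law_uniform, Alg.law_ret]
      rfl
    · simp only [PMF.support_map, Set.mem_image] at hy
      obtain ⟨i, -, rfl⟩ := hy
      exact List.get_mem _ _
    · rw [expect_map]
      refine (expect_uniform (n := l.length + 1) (fun i => f ((x :: l).get i))
        fun i => hf _).trans ?_
      congr 2
      have h := List.sum_ofFn (f := f ∘ (x :: l).get)
      rw [← List.map_ofFn, List.ofFn_get] at h
      exact h.symm

end Stage

/-! ### Accuracy of the whole sequence of stages -/

section Stages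

variable {m : ℕ} [NeZero m] {U : Type u} [DecidableEq U]

theorem law_randomIndex (A : Fin m → Finset U) (gen : Fin m → PMF U) :
    (randomIndex : Alg m U (Fin m)).law A gen = PMF.uniformOfFintype (Fin m) := by
  simp [randomIndex]

/-- Replacing a list by sufficiently many random members of it hardly changes the estimate. -/
theorem resample_le (A : Fin m → Finset U) (gen : Fin m → PMF U) {R : List U} (hR : R ≠ [])
    {c η g : ℝ} {h : ℕ} (hh : 0 < h) (hT : ∀ x ∈ R, 1 ≤ thickness A x ∧ (thickness A x : ℝ) ≤ c)
    (hη₀ : 0 ≤ η) (hη : η ≤ 1) (hg : 0 < g) (hlog : Real.log (2 / g) ≤ η ^ 2 * (h / c) / 4) :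
    ((randomSamples R h : Alg m U (List U)).law A gen).toOuterMeasure
      {l | ¬ ((1 - η) * (R.map (invThickness A)).sum ≤
          (R.length : ℝ) / h * (l.map (invThickness A)).sum ∧
        (R.length : ℝ) / h * (l.map (invThickness A)).sum ≤
          (1 + η) * (R.map (invThickness A)).sum)} ≤ ENNReal.ofReal g := by
  obtain ⟨p, hp, -, hexp⟩ := law_randomSamples A gen hR (invThickness A)
    fun x => (invThickness_mem A x).1
  have hlen : (0 : ℝ) < R.length := Nat.cast_pos.2 (List.length_pos_iff.2 hR)
  have hh' : (0 : ℝ) < h := Nat.cast_pos.2 hh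
  -- Thickness at most c means weight at least 1/c, so h samples have expected total weight at least
  -- h/c, the quantity in `hlog`.
  have hmean : 1 / c ≤ (R.map (invThickness A)).sum / R.length := by
    rw [le_div_iff₀ hlen, mul_comm, ← nsmul_eq_mul]
    have := List.card_nsmul_le_sum (R.map (invThickness A)) (1 / c) (fun y hy => by
      obtain ⟨x, hx, rfl⟩ := List.mem_map.1 hy
      have h1 : (0 : ℝ) < thickness A x := Nat.cast_pos.2 (hT x hx).1
      exact one_div_le_one_div_of_le h1 (hT x hx).2)
    simpa using this
  rw [hp]
  refine le_trans (MeasureTheory.measure_mono fun l hl => ?_)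
    (chernoff p (invThickness A) (invThickness_mem A)
      (div_nonneg (sum_invThickness_nonneg A R) hlen.le) hη₀ hη hexp h hg ?_)
  · simp only [Set.mem_ofPred_eq] at hl ⊢
    contrapose! hl
    obtain ⟨h1, h2⟩ := hl
    have h3 : 0 < (R.length : ℝ) / h := by positivity
    have e1 := mul_le_mul_of_nonneg_left h1 h3.le
    have e2 := mul_le_mul_of_nonneg_left h2 h3.le
    constructor
    · refine le_trans (le_of_eq ?_) e1
      field_simp
    · refine le_trans e2 (le_of_eq ?_)
      field_simp
  · refine hlog.trans ?_
    have : (h : ℝ) / c = h * (1 / c) := by ring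
    rw [this]
    gcongr

theorem resample_support (A : Fin m → Finset U) (gen : Fin m → PMF U) {R : List U} (hR : R ≠ [])
    {h : ℕ} {l : List U} (hl : l ∈ ((randomSamples R h : Alg m U (List U)).law A gen).support) :
    l.length = h ∧ ∀ x ∈ l, x ∈ R := by
  obtain ⟨p, hp, hsupp, -⟩ := law_randomSamples A gen hR (invThickness A)
    fun x => (invThickness_mem A x).1
  rw [hp] at hl
  exact ⟨length_of_mem_support_iid hl, fun x hx => hsupp x (mem_support_of_mem_iid hl hx)⟩

/-- The effect of one stage with good counts. -/
theorem stage_of_goodCount (A : Fin m → Finset U) {R : List U} {S : U → ℕ} {e c : ℝ} {k : ℕ}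
    (hgood : ∀ x ∈ R, GoodCount m e c k (thickness A x) (S x))
    (hT : ∀ x ∈ R, 1 ≤ thickness A x) (hk : 0 < k) (he₀ : 0 < e) (he : e ≤ 1 / 2)
    (P : U → Prop) [DecidablePred P] (hP : ∀ x ∈ R, (P x ↔ c / (2 * 8 * m) * k ≤ S x)) :
    (∀ x ∈ R.filter fun x => ¬ P x, 1 ≤ thickness A x ∧ (thickness A x : ℝ) ≤ c / 8 ∧
      (thickness A x : ℝ) < c / 8) ∧
    (1 - 2 * e) * ((R.filter fun x => P x).map (invThickness A)).sum ≤
      ((R.filter fun x => P x).map fun x => (k : ℝ) / (S x * m)).sum ∧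
    ((R.filter fun x => P x).map fun x => (k : ℝ) / (S x * m)).sum ≤
      (1 + 2 * e) * ((R.filter fun x => P x).map (invThickness A)).sum := by
  refine ⟨fun x hx => ?_, sum_map_mem_of_forall _ _ _ _ _ fun x hx => ?_⟩
  · simp only [List.mem_filter, decide_eq_true_eq] at hx
    have : (thickness A x : ℝ) < c / 8 := by
      by_contra h
      exact hx.2 ((hP x hx.1).2 ((hgood x hx.1).1 (not_lt.1 h)))
    exact ⟨hT x hx.1, this.le, this⟩
  · simp only [List.mem_filter, decide_eq_true_eq] at hx
    exact (hgood x hx.1).estimate ((hP x hx.1).1 hx.2) (hT x hx.1) hk he₀ he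

/-- Induction on a bound j for the stages still needed, expressed by ct < 8^j; n is only the
recursion bound of `stages`. With V the removed and rest the remaining elements, the new Φ replaces
the weight of V by its estimate and the weight of rest by that of a resample. Each is right up to 1
± 2e, hence so is the total. A stage fails with probability at most g₂ for the counts, by a union
bound over at most h₁ elements with g₃ each, and at most g₂ for the resampling. -/
theorem law_stages (A : Fin m → Finset U) (gen : Fin m → PMF U) (p : Params) (hf₁ : p.f₁ = 8)
    (hz : p.zmin = 1) {M e g₂ g₃ : ℝ} {h₁ : ℕ} (hM : 0 ≤ M) (he₀ : 0 < e) (he : e ≤ 1 / 2)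
    (hg₂ : 0 < g₂) (hg₃₀ : 0 < g₃) (hg₃ : g₃ ≤ 1) (hh₁ : 0 < h₁) (hgg : h₁ * g₃ ≤ g₂)
    (hf₆ : p.f₆ m = 8 * (24 / e ^ 2 * Real.log (2 / g₃)))
    (hlog : Real.log (2 / g₂) ≤ (2 * e) ^ 2 * (h₁ / m) / 4) (j : ℕ) :
    ∀ (n : ℕ) (ct wt sum : ℝ) (R : List U), j ≤ n → 1 ≤ ct → ct < 8 ^ j → ct ≤ m → 0 ≤ wt →
      0 ≤ sum → (∀ x ∈ R, 1 ≤ thickness A x ∧ (thickness A x : ℝ) ≤ ct) → R.length ≤ h₁ →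
      ((stages p M h₁ n ct wt sum R : Alg m U ℝ).law A gen).toOuterMeasure
        {y | ¬ ((1 - 2 * e) ^ j * ((sum + wt * (R.map (invThickness A)).sum) * M) ≤ y ∧
          y ≤ (1 + 2 * e) ^ j * ((sum + wt * (R.map (invThickness A)).sum) * M))} ≤
        j * (2 * ENNReal.ofReal g₂) := by
  have hm : (0 : ℝ) < m := Nat.cast_pos.2 (NeZero.pos m)
  have hh₁' : (0 : ℝ) < h₁ := Nat.cast_pos.2 hh₁
  induction j with
  | zero =>
    intro n ct wt sum R _ h1 h2
    rw [pow_zero] at h2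
    exact absurd h1 (not_le.2 h2)
  | succ j ih =>
    intro n ct wt sum R hn hct hct' hctm hwt hsum hR hRlen
    obtain ⟨n, rfl⟩ : ∃ n', n = n' + 1 := ⟨n - 1, by omega⟩
    have hct₀ : 0 < ct := by linarith
    have hη : 0 ≤ 1 - 2 * e := by linarith
    rw [stages]
    simp only [Alg.law_step, Alg.law_bind, Alg.law_round, Alg.law_iterate, law_randomIndex,
      drawAll, PMF.pure_bind, hf₁, hz, Nat.cast_one]
    set k : ℕ := ⌈(m : ℝ) / ct * p.f₆ m⌉₊ with hk
    have hkpos : 0 < k := by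
      rw [hk, Nat.ceil_pos, hf₆]
      have : 0 < Real.log (2 / g₃) := Real.log_pos ((one_lt_div hg₃₀).2 (by linarith))
      positivity
    set h : ℕ := ⌈(h₁ : ℝ) / (m / (ct / 8))⌉₊ with hh
    have hhpos : 0 < h := by
      rw [hh, Nat.ceil_pos]; positivity
    have hhle : h ≤ h₁ := by
      rw [hh, Nat.ceil_le]
      refine div_le_self hh₁'.le ((one_le_div (by positivity)).2 (by linarith))
    have hcnt : (↑(j + 1) : ℝ≥0∞) * (2 * ENNReal.ofReal g₂) =
        ENNReal.ofReal g₂ + (ENNReal.ofReal g₂ + j * (2 * ENNReal.ofReal g₂)) := by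
      push_cast; ring
    rw [hcnt]
    refine (toOuterMeasure_bind_le _ _
      {H | ∃ x ∈ R, ¬ GoodCount m e ct k (thickness A x) (hits A H x)} _ _
      fun H hH hgood => ?_).trans (add_le_add ?_ le_rfl)
    swap
    · refine (toOuterMeasure_exists_mem_le _
        (fun H x => ¬ GoodCount m e ct k (thickness A x) (hits A H x)) (ENNReal.ofReal g₃) R
        fun x hx => ?_).trans ?_
      · exact goodCount_of_iid A x he₀ he hct₀ hg₃₀ hg₃ (by rw [← hf₆]; exact Nat.le_ceil _)
      · rw [← ENNReal.ofReal_natCast, ← ENNReal.ofReal_mul (by positivity)]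
        refine ENNReal.ofReal_le_ofReal (le_trans ?_ hgg)
        have : (R.length : ℝ) ≤ h₁ := by exact_mod_cast hRlen
        gcongr
    simp only [Set.mem_ofPred_eq, not_exists, not_and, not_not] at hgood
    set S : U → ℕ := fun x => List.countP (fun i => decide ((x, i) ∈ R ×ˢ H ∧ x ∈ A i)) H with hS
    -- The answer table is false off the queried pairs, but every pair from R and H was queried.
    have hSR : ∀ x ∈ R, S x = hits A H x := by
      intro x hx
      refine List.countP_congr fun i hi => ?_
      simp [hx, hi]
    obtain ⟨hrest, hY₁, hY₂⟩ := stage_of_goodCount A (S := S) (e := e) (c := ct) (k := k)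
      (fun x hx => by rw [hSR x hx]; exact hgood x hx) (fun x hx => (hR x hx).1) hkpos he₀ he
      (fun x => ct / (2 * 8 * m) * k ≤ S x) (fun _ _ => Iff.rfl)
    have hsplit := sum_map_filter_add R (fun x => ct / (2 * 8 * m) * k ≤ S x) (invThickness A)
    have hrestlen : (R.filter fun x => ¬ ct / (2 * 8 * m) * k ≤ S x).length ≤ h₁ :=
      (List.length_filter_le _ _).trans hRlen
    have hV₀ := sum_invThickness_nonneg A (R.filter fun x => ct / (2 * 8 * m) * k ≤ S x)
    have hrest₀ := sum_invThickness_nonneg A (R.filter fun x => ¬ ct / (2 * 8 * m) * k ≤ S x)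
    set V := R.filter fun x => ct / (2 * 8 * m) * k ≤ S x with hV
    set rest := R.filter fun x => ¬ ct / (2 * 8 * m) * k ≤ S x with hrst
    set Y := (V.map fun x => (k : ℝ) / (S x * m)).sum with hY
    have hY₀ : 0 ≤ Y := (mul_nonneg hη hV₀).trans hY₁
    have hwY : 0 ≤ wt * Y := mul_nonneg hwt hY₀
    set Φ := sum + wt * (R.map (invThickness A)).sum with hΦ
    have hΦV : Φ = sum + wt * (V.map (invThickness A)).sum +
        wt * (rest.map (invThickness A)).sum := by rw [hΦ, ← hsplit]; ring
    -- the estimate after the stage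
    have hnext : ∀ z, (1 - 2 * e) * (rest.map (invThickness A)).sum ≤ z →
        z ≤ (1 + 2 * e) * (rest.map (invThickness A)).sum →
        (1 - 2 * e) * Φ ≤ sum + wt * Y + wt * z ∧
          sum + wt * Y + wt * z ≤ (1 + 2 * e) * Φ := by
      intro z hz1 hz2
      have a1 := mul_le_mul_of_nonneg_left hY₁ hwt
      have a2 := mul_le_mul_of_nonneg_left hY₂ hwt
      have a3 := mul_le_mul_of_nonneg_left hz1 hwt
      have a4 := mul_le_mul_of_nonneg_left hz2 hwt
      have a5 := mul_nonneg he₀.le hsum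
      rw [hΦV]
      constructor <;> nlinarith
    have hΦ₀ : 0 ≤ Φ := add_nonneg hsum (mul_nonneg hwt (sum_invThickness_nonneg A R))
    by_cases hend : ct / 8 < 1
    · have hnil : rest = [] := by
        refine List.eq_nil_iff_forall_not_mem.2 fun x hx => ?_
        obtain ⟨h1, -, h2⟩ := hrest x hx
        have : (1 : ℝ) ≤ thickness A x := by exact_mod_cast h1
        linarith
      simp only [if_pos hend, Alg.law_ret]
      -- The next list is still formed before the algorithm stops, but the returned value does not
      -- depend on it.
      refine (toOuterMeasure_bind_le _ _ ∅ _ 0 fun a _ _ => ?_).trans (by simp)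
      rw [toOuterMeasure_le_of_support]
      intro y hy
      simp only [PMF.support_pure, Set.mem_singleton_iff] at hy
      subst hy
      simp only [Set.mem_ofPred_eq, not_not]
      obtain ⟨b1, b2⟩ := hnext 0 (by simp [hnil]) (by simp [hnil])
      rw [mul_zero, add_zero] at b1 b2
      have c1 := mul_le_mul_of_nonneg_right b1 hM
      have c2 := mul_le_mul_of_nonneg_right b2 hM
      have hΦM : 0 ≤ Φ * M := mul_nonneg hΦ₀ hM
      constructor
      · refine le_trans ?_ c1
        rw [mul_assoc]
        gcongr
        rw [pow_succ]
        exact mul_le_of_le_one_left hη (pow_le_one₀ hη (by linarith))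
      · refine c2.trans ?_
        rw [mul_assoc]
        gcongr
        rw [pow_succ]
        exact le_mul_of_one_le_left (by linarith) (one_le_pow₀ (by linarith))
    · simp only [if_neg hend]
      push Not at hend
      have hrec : ∀ (wt' : ℝ) (R' : List U), 0 ≤ wt' → (∀ x ∈ R', x ∈ rest) → R'.length ≤ h₁ →
          (1 - 2 * e) * (rest.map (invThickness A)).sum ≤
            wt' * (R'.map (invThickness A)).sum →
          wt' * (R'.map (invThickness A)).sum ≤ (1 + 2 * e) * (rest.map (invThickness A)).sum →
          ((stages p M h₁ n (ct / 8) (wt * wt') (sum + wt * Y) R' : Alg m U ℝ).law A gen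
            ).toOuterMeasure {y | ¬ ((1 - 2 * e) ^ (j + 1) * (Φ * M) ≤ y ∧
              y ≤ (1 + 2 * e) ^ (j + 1) * (Φ * M))} ≤ j * (2 * ENNReal.ofReal g₂) := by
        intro wt' R' hwt' hR' hlen' hl hu
        refine le_trans (MeasureTheory.measure_mono fun y hy => ?_)
          (ih n (ct / 8) (wt * wt') (sum + wt * Y) R' (by omega) hend
            (by rw [pow_succ] at hct'; linarith) (by linarith) (mul_nonneg hwt hwt')
            (add_nonneg hsum hwY) (fun x hx => ?_) hlen')
        · simp only [Set.mem_ofPred_eq] at hy ⊢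
          contrapose! hy
          obtain ⟨b1, b2⟩ := hnext _ hl hu
          rw [← mul_assoc] at b1 b2
          have c1 := mul_le_mul_of_nonneg_right b1 hM
          have c2 := mul_le_mul_of_nonneg_right b2 hM
          refine ⟨le_trans ?_ hy.1, hy.2.trans ?_⟩
          · rw [pow_succ, mul_assoc (_ ^ j), ← mul_assoc (1 - 2 * e) Φ M]
            gcongr
          · rw [pow_succ, mul_assoc (_ ^ j), ← mul_assoc (1 + 2 * e) Φ M]
            gcongr
        · exact ⟨(hrest x (hR' x hx)).1, (hrest x (hR' x hx)).2.1⟩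
      by_cases hlt : rest.length < h
      · simp only [if_pos hlt, Alg.law_ret, PMF.pure_bind]
        refine (hrec 1 rest zero_le_one (fun _ h => h) hrestlen ?_ ?_).trans le_add_self
        · rw [one_mul]; exact mul_le_of_le_one_left hrest₀ (by linarith)
        · rw [one_mul]; exact le_mul_of_one_le_left hrest₀ (by linarith)
      · simp only [if_neg hlt, Alg.law_bind, Alg.law_ret, PMF.bind_bind, PMF.pure_bind]
        have hne : rest ≠ [] := by
          rintro h0
          rw [h0] at hlt
          exact hlt hhpos
        refine (toOuterMeasure_bind_le _ _ _ _ (j * (2 * ENNReal.ofReal g₂))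
          fun l hl hlgood => ?_).trans (add_le_add (resample_le A gen hne (c := ct / 8)
            (η := 2 * e) (g := g₂) hhpos
            (fun x hx => ⟨(hrest x hx).1, (hrest x hx).2.1⟩) (by linarith) (by linarith) hg₂
            (hlog.trans ?_)) le_rfl)
        · simp only [Set.mem_ofPred_eq, not_not] at hlgood
          obtain ⟨d1, d2⟩ := resample_support A gen hne hl
          exact hrec _ l (by positivity) d2 (by omega) hlgood.1 hlgood.2
        -- The sample size h is chosen so that its ratio to the new thickness does not fall below
        -- h₁/m; one hypothesis `hlog` therefore serves all stages.
        · have : (h₁ : ℝ) / m ≤ h / (ct / 8) := by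
            rw [le_div_iff₀ (by positivity)]
            refine le_trans (le_of_eq ?_) (Nat.le_ceil _)
            field_simp
          gcongr

end Stages

/-! ### The initial samples and the size of the union -/

section Sampling

theorem weightedIndex_apply {m : ℕ} [NeZero m] (w : Fin m → ℝ) (hw : ∀ i, 0 ≤ w i)
    (hs : 0 < ∑ i, w i) (i : Fin m) :
    weightedIndex w i = ENNReal.ofReal (w i / ∑ j, w j) := by
  have h : ∑' j, ENNReal.ofReal (w j) = ENNReal.ofReal (∑ j, w j) := by
    rw [tsum_fintype, ENNReal.ofReal_sum_of_nonneg fun j _ => hw j]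
  have h0 : ∑' j, ENNReal.ofReal (w j) ≠ 0 := by
    rw [h]; simpa using hs
  rw [weightedIndex, dif_pos h0, PMF.normalize_apply, h, div_eq_mul_inv,
    ENNReal.ofReal_mul (hw i), ENNReal.ofReal_inv_of_pos hs]

variable {m : ℕ} {U : Type u} {αL αR βL βR : ℝ} (L : ApproxList m U αL αR βL βR)

namespace ApproxList

theorem sum_gen (i : Fin m) : ∑ x ∈ L.A i, (L.gen i x).toReal = 1 := by
  rw [← ENNReal.toReal_sum fun x _ => (L.gen i).apply_ne_top x, ← tsum_eq_sum (L := .unconditional U)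
    fun x hx => L.gen_eq_zero i x hx, (L.gen i).tsum_coe, ENNReal.toReal_one]

theorem card_pos (i : Fin m) : 0 < (L.A i).card := by
  rw [Finset.card_pos, Finset.nonempty_iff_ne_empty]
  intro h
  have := L.sum_gen i
  simp [h] at this

theorem size_pos (hβL : βL < 1) (i : Fin m) : 0 < L.size i :=
  lt_of_lt_of_le (mul_pos (by linarith) (Nat.cast_pos.2 (L.card_pos i))) (L.size_mem i).1

theorem sum_size_pos [NeZero m] (hβL : βL < 1) : 0 < ∑ i, L.size i :=
  Finset.sum_pos (fun i _ => L.size_pos hβL i) ⟨0, Finset.mem_univ _⟩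

variable [DecidableEq U]

/-- The expected weight of an element from the set with index `i`. -/
noncomputable def setMean (i : Fin m) : ℝ :=
  ∑ x ∈ L.A i, (L.gen i x).toReal * invThickness L.A x

theorem setMean_nonneg (i : Fin m) : 0 ≤ L.setMean i :=
  Finset.sum_nonneg fun x _ => mul_nonneg ENNReal.toReal_nonneg (invThickness_mem L.A x).1

theorem thickness_pos {i : Fin m} {x : U} (hx : x ∈ L.A i) : 1 ≤ thickness L.A x :=
  Finset.card_pos.2 ⟨i, by simpa using hx⟩

theorem one_div_le_setMean (i : Fin m) : 1 / (m : ℝ) ≤ L.setMean i := by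
  have h : 1 / (m : ℝ) = 1 / m * ∑ x ∈ L.A i, (L.gen i x).toReal := by rw [L.sum_gen, mul_one]
  rw [h, Finset.mul_sum, setMean]
  refine Finset.sum_le_sum fun x hx => ?_
  rw [mul_comm]
  refine mul_le_mul_of_nonneg_left ?_ ENNReal.toReal_nonneg
  have h1 : (0 : ℝ) < thickness L.A x := Nat.cast_pos.2 (L.thickness_pos hx)
  have h2 : (thickness L.A x : ℝ) ≤ m := by exact_mod_cast thickness_le L.A x
  exact one_div_le_one_div_of_le h1 h2

theorem expect_gen (i : Fin m) :
    expect (L.gen i) (fun x => ENNReal.ofReal (invThickness L.A x)) =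
      ENNReal.ofReal (L.setMean i) := by
  rw [expect, tsum_eq_sum (s := L.A i) fun x hx => by rw [L.gen_eq_zero i x hx, zero_mul], setMean,
    ENNReal.ofReal_sum_of_nonneg fun x _ =>
      mul_nonneg ENNReal.toReal_nonneg (invThickness_mem L.A x).1]
  refine Finset.sum_congr rfl fun x _ => ?_
  rw [ENNReal.ofReal_mul ENNReal.toReal_nonneg, ENNReal.ofReal_toReal ((L.gen i).apply_ne_top x)]

/-- Double counting: x occurs in T(x) of the inner sums, each time with weight 1/T(x). -/
theorem sum_sum_invThickness :
    ∑ i, ∑ x ∈ L.A i, invThickness L.A x = ((Finset.univ.biUnion L.A).card : ℝ) := by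
  rw [Finset.sum_comm' (t' := Finset.univ.biUnion L.A)
    (s' := fun x => Finset.univ.filter fun i => x ∈ L.A i)]
  · rw [Finset.card_eq_sum_ones, Nat.cast_sum]
    refine Finset.sum_congr rfl fun x hx => ?_
    obtain ⟨i, -, hi⟩ := Finset.mem_biUnion.1 hx
    have h1 : (0 : ℝ) < thickness L.A x := Nat.cast_pos.2 (L.thickness_pos hi)
    rw [Finset.sum_const, nsmul_eq_mul, Nat.cast_one]
    exact mul_one_div_cancel h1.ne'
  · intro i x
    simp only [Finset.mem_univ, true_and, Finset.mem_filter, Finset.mem_biUnion]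
    exact ⟨fun h => ⟨h, i, h⟩, fun h => h.1⟩

variable [NeZero m]

/-- The expected weight of an initial sample. -/
noncomputable def mean : ℝ := (∑ i, L.size i * L.setMean i) / ∑ i, L.size i

theorem one_div_le_mean (hβL : βL < 1) : 1 / (m : ℝ) ≤ L.mean := by
  rw [mean, le_div_iff₀ (L.sum_size_pos hβL), Finset.mul_sum]
  refine Finset.sum_le_sum fun i _ => ?_
  rw [mul_comm]
  exact mul_le_mul_of_nonneg_left (L.one_div_le_setMean i) (L.size_pos hβL i).le

/-- The distribution of one initial sample. -/
noncomputable def sample : PMF U := (weightedIndex L.size).bind L.gen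

theorem expect_sample (hβL : βL < 1) :
    expect L.sample (fun x => ENNReal.ofReal (invThickness L.A x)) = ENNReal.ofReal L.mean := by
  have hs := L.sum_size_pos hβL
  rw [sample, expect_bind]
  simp only [L.expect_gen]
  rw [expect, tsum_fintype, mean, Finset.sum_div, ENNReal.ofReal_sum_of_nonneg fun i _ =>
    div_nonneg (mul_nonneg (L.size_pos hβL i).le (L.setMean_nonneg i)) hs.le]
  refine Finset.sum_congr rfl fun i _ => ?_
  rw [weightedIndex_apply _ (fun i => (L.size_pos hβL i).le) hs,
    ← ENNReal.ofReal_mul (div_nonneg (L.size_pos hβL i).le hs.le)]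
  congr 1; ring

theorem thickness_pos_of_mem_support {x : U} (hx : x ∈ L.sample.support) :
    1 ≤ thickness L.A x := by
  obtain ⟨i, -, hi⟩ := (PMF.mem_support_bind_iff _ _ _).1 hx
  by_contra h
  exact (PMF.mem_support_iff _ _).1 hi (L.gen_eq_zero i x fun hA => h (L.thickness_pos hA))

theorem mean_mul_sum_size (hβL : βL < 1) :
    L.mean * ∑ i, L.size i =
      ∑ i, ∑ x ∈ L.A i, L.size i * (L.gen i x).toReal * invThickness L.A x := by
  rw [mean, div_mul_cancel₀ _ (L.sum_size_pos hβL).ne']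
  simp only [setMean, Finset.mul_sum, mul_assoc]

theorem le_mean_mul (hαL : αL < 1) (hβL : βL < 1) :
    (1 - αL) * (1 - βL) * ((Finset.univ.biUnion L.A).card : ℝ) ≤ L.mean * ∑ i, L.size i := by
  rw [L.mean_mul_sum_size hβL, ← L.sum_sum_invThickness, Finset.mul_sum]
  refine Finset.sum_le_sum fun i _ => ?_
  rw [Finset.mul_sum]
  refine Finset.sum_le_sum fun x hx => ?_
  refine mul_le_mul_of_nonneg_right ?_ (invThickness_mem L.A x).1
  have hc : (0 : ℝ) < (L.A i).card := Nat.cast_pos.2 (L.card_pos i)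
  calc (1 - αL) * (1 - βL) = (1 - βL) * (L.A i).card * ((1 - αL) / (L.A i).card) := by
        field_simp
    _ ≤ _ := mul_le_mul (L.size_mem i).1 (L.gen_mem i x hx).1
        (div_nonneg (by linarith) hc.le) (L.size_pos hβL i).le

theorem mean_mul_le (hβL : βL < 1) (hβR : 0 ≤ βR) :
    L.mean * ∑ i, L.size i ≤ (1 + αR) * (1 + βR) * ((Finset.univ.biUnion L.A).card : ℝ) := by
  rw [L.mean_mul_sum_size hβL, ← L.sum_sum_invThickness, Finset.mul_sum]
  refine Finset.sum_le_sum fun i _ => ?_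
  rw [Finset.mul_sum]
  refine Finset.sum_le_sum fun x hx => ?_
  refine mul_le_mul_of_nonneg_right ?_ (invThickness_mem L.A x).1
  have hc : (0 : ℝ) < (L.A i).card := Nat.cast_pos.2 (L.card_pos i)
  calc _ ≤ (1 + βR) * (L.A i).card * ((1 + αR) / (L.A i).card) :=
        mul_le_mul (L.size_mem i).2 (L.gen_mem i x hx).2 ENNReal.toReal_nonneg (by positivity)
    _ = (1 + αR) * (1 + βR) := by field_simp

end ApproxList

theorem law_approximateUnion [NeZero m] [DecidableEq U] (p : Params) (M : ℝ) :
    ((approximateUnion p L.size M).law L.A L.gen : PMF ℝ) = (iid L.sample ⌈p.f₅ m⌉₊).bind fun R =>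
      (stages p M ⌈p.f₅ m⌉₊ m p.zmax (1 / ⌈p.f₅ m⌉₊) 0 R).law L.A L.gen := by
  rw [approximateUnion, ApproxList.sample, ← iid_bind_drawAll, PMF.bind_bind]
  simp only [Alg.law_step, Alg.law_bind, Alg.law_round, Alg.law_iterate, randomSet,
    Alg.law_weighted, Alg.law_ret, PMF.bind_pure]

/-- The exponent is log₈ m + 1 for the stages, as m < 8^(log₈ m + 1), plus one for the initial
sampling, where μ ≥ 1/m makes `hlog` sufficient. -/
theorem law_approximateUnion_le [NeZero m] [DecidableEq U] (p : Params) (hβL : βL < 1) (hf₁ : p.f₁ = 8)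
    (hz : p.zmin = 1) (hz' : p.zmax = m) {e g₂ g₃ : ℝ} (he₀ : 0 < e) (he : e ≤ 1 / 2)
    (hg₂ : 0 < g₂) (hg₃₀ : 0 < g₃) (hg₃ : g₃ ≤ 1) (hm : 2 ≤ m)
    (hh₁ : 0 < ⌈p.f₅ m⌉₊) (hgg : ⌈p.f₅ m⌉₊ * g₃ ≤ g₂)
    (hf₆ : p.f₆ m = 8 * (24 / e ^ 2 * Real.log (2 / g₃)))
    (hlog : Real.log (2 / g₂) ≤ (2 * e) ^ 2 * (⌈p.f₅ m⌉₊ / m) / 4) :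
    ((approximateUnion p L.size (∑ i, L.size i)).law L.A L.gen : PMF ℝ).toOuterMeasure
      {y | ¬ ((1 - 2 * e) ^ (Nat.log 8 m + 2) * (L.mean * ∑ i, L.size i) ≤ y ∧
        y ≤ (1 + 2 * e) ^ (Nat.log 8 m + 2) * (L.mean * ∑ i, L.size i))} ≤
      ENNReal.ofReal g₂ + (Nat.log 8 m + 1 : ℕ) * (2 * ENNReal.ofReal g₂) := by
  have hM := L.sum_size_pos hβL
  have hm0 : (0 : ℝ) < m := Nat.cast_pos.2 (NeZero.pos m)
  have hmean := L.one_div_le_mean hβL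
  have hmean₀ : 0 ≤ L.mean := le_trans (by positivity) hmean
  have hη : 0 ≤ 1 - 2 * e := by linarith
  rw [law_approximateUnion]
  set h₁ : ℕ := ⌈p.f₅ m⌉₊ with hh
  have hh₁' : (0 : ℝ) < h₁ := Nat.cast_pos.2 hh₁
  refine (toOuterMeasure_bind_le _ _ _ _ _ fun R hR hgood => ?_).trans (add_le_add
    (chernoff L.sample (invThickness L.A) (invThickness_mem L.A) hmean₀ (η := 2 * e)
      (by linarith) (by linarith) (L.expect_sample hβL) h₁ hg₂ (hlog.trans ?_)) le_rfl)
  swap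
  · rw [div_eq_mul_one_div (h₁ : ℝ) (m : ℝ)]
    gcongr
  simp only [Set.mem_ofPred_eq, not_not] at hgood
  have hpow : m < 8 ^ (Nat.log 8 m + 1) := Nat.lt_pow_succ_log_self (by norm_num) m
  refine le_trans (MeasureTheory.measure_mono fun y hy => ?_)
    (law_stages L.A L.gen p hf₁ hz hM.le he₀ he hg₂ hg₃₀ hg₃ hh₁ hgg hf₆ hlog
      (Nat.log 8 m + 1) m p.zmax (1 / h₁) 0 R (Nat.log_lt_self 8 (NeZero.ne m))
      (by rw [hz']; exact_mod_cast NeZero.pos m) (by rw [hz']; exact_mod_cast hpow)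
      (by rw [hz']) (by positivity) le_rfl (fun x hx => ⟨?_, ?_⟩) ?_)
  · simp only [Set.mem_ofPred_eq] at hy ⊢
    contrapose! hy
    rw [zero_add] at hy
    obtain ⟨h1, h2⟩ := hgood
    have b1 : (1 - 2 * e) * L.mean ≤ 1 / h₁ * (R.map (invThickness L.A)).sum := by
      rw [div_mul_eq_mul_div, one_mul, le_div_iff₀ hh₁']
      linarith
    have b2 : 1 / h₁ * (R.map (invThickness L.A)).sum ≤ (1 + 2 * e) * L.mean := by
      rw [div_mul_eq_mul_div, one_mul, div_le_iff₀ hh₁']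
      linarith
    have c1 := mul_le_mul_of_nonneg_right b1 hM.le
    have c2 := mul_le_mul_of_nonneg_right b2 hM.le
    refine ⟨le_trans ?_ hy.1, hy.2.trans ?_⟩
    · rw [pow_succ _ (Nat.log 8 m + 1), mul_assoc (_ ^ (Nat.log 8 m + 1)), ← mul_assoc (1 - 2 * e)]
      gcongr
    · rw [pow_succ _ (Nat.log 8 m + 1), mul_assoc (_ ^ (Nat.log 8 m + 1)), ← mul_assoc (1 + 2 * e)]
      gcongr
  · exact L.thickness_pos_of_mem_support (mem_support_of_mem_iid hR hx)
  · rw [hz']; exact_mod_cast thickness_le L.A x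
  · exact (length_of_mem_support_iid hR).le

end Sampling

/-! ### Inequalities between the parameters -/

section Parameters

theorem one_le_logb_two {m : ℕ} (hm : 2 ≤ m) : 1 ≤ Real.logb 2 m := by
  rw [Real.le_logb_iff_rpow_le (by norm_num) (by positivity), Real.rpow_one]
  exact_mod_cast hm

theorem three_mul_log_eight_le (m : ℕ) : 3 * (Nat.log 8 m : ℝ) ≤ Real.logb 2 m := by
  have h := Real.natLog_le_logb m 8
  have h8 : Real.logb (8 : ℕ) m = Real.logb 2 m / 3 := by
    have : Real.log ((8 : ℕ) : ℝ) = 3 * Real.log 2 := by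
      rw [show ((8 : ℕ) : ℝ) = 2 ^ 3 by norm_num, Real.log_pow]; norm_num
    rw [Real.logb, Real.logb, this]
    field_simp
  rw [h8] at h
  linarith

/-- The parameters of the algorithm for lists of `m` sets. -/
def params (m : ℕ) (γ ε : ℝ) : Params := ⟨8, 1, m, γ, ε⟩

variable {m : ℕ} {γ ε : ℝ}

theorem params_ε₁ : (params m γ ε).ε₁ m = ε / (54 * Real.logb 2 m) := by
  simp only [Params.ε₁, Params.ε₀, params]
  rw [div_div]; congr 1; ring

theorem params_ε₂ : (params m γ ε).ε₂ m = ε / (216 * Real.logb 2 m) := by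
  rw [Params.ε₂, params_ε₁, div_div]; congr 1; ring

theorem params_ε₃ : (params m γ ε).ε₃ = ε / 27 := by
  simp only [Params.ε₃, Params.ε₀, params]
  ring

theorem params_γ₂ : (params m γ ε).γ₂ m = γ / (6 * Real.logb 2 m) := rfl

theorem params_f₂ : (params m γ ε).f₂ m = 2 * ((params m γ ε).v m : ℝ) / (ε / 27) +
    2 * Real.logb 2 m / ((ε / 27) * Real.logb 2 (1 + (params m γ ε).δ m)) := by
  rw [Params.f₂, params_ε₃]
  simp [params]

theorem params_f₄ : (params m γ ε).f₄ m =
    (params m γ ε).f₂ m * Real.logb 2 ((m : ℝ) ^ 2 / (params m γ ε).ε₁ m) /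
      (6 * (params m γ ε).ε₁ m ^ 2) +
    6 * Real.log (2 / (params m γ ε).γ₂ m) / (params m γ ε).ε₂ m ^ 3 := by
  rw [Params.f₄, Params.f₃]
  congr 1
  have : (params m γ ε).f₁ = 8 := rfl
  rw [this, mul_comm _ (8 : ℝ), mul_div_mul_left _ _ (by norm_num), div_div]
  congr 1

theorem params_f₅ : (params m γ ε).f₅ m = m * (params m γ ε).f₄ m := by
  simp [Params.f₅, params]

theorem params_f₆ : (params m γ ε).f₆ m = 8 * (24 / (params m γ ε).ε₁ m ^ 2 *
    Real.log (2 / (params m γ ε).γ₃ m)) := rfl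

theorem params_ε₁_mem (hm : 2 ≤ m) (hε : ε ∈ Set.Ioo (0 : ℝ) 1) :
    (params m γ ε).ε₁ m ∈ Set.Ioc (0 : ℝ) (1 / 54) := by
  have hl := one_le_logb_two hm
  obtain ⟨h0, h1⟩ := hε
  rw [params_ε₁]
  refine ⟨by positivity, ?_⟩
  rw [div_le_div_iff₀ (by positivity) (by norm_num)]
  linarith

theorem params_δ_mem (hm : 2 ≤ m) (hε : ε ∈ Set.Ioo (0 : ℝ) 1) :
    (params m γ ε).δ m ∈ Set.Ioc (0 : ℝ) 1 := by
  obtain ⟨h0, h1⟩ := params_ε₁_mem (γ := γ) hm hε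
  rw [Params.δ, Params.ε₂]
  exact ⟨by positivity, by linarith⟩

theorem params_γ₂_mem (hm : 2 ≤ m) (hγ : γ ∈ Set.Ioo (0 : ℝ) 1) :
    (params m γ ε).γ₂ m ∈ Set.Ioc (0 : ℝ) (1 / 6) := by
  have hl := one_le_logb_two hm
  obtain ⟨h0, h1⟩ := hγ
  rw [params_γ₂]
  refine ⟨by positivity, ?_⟩
  rw [div_le_div_iff₀ (by positivity) (by norm_num)]
  linarith

theorem one_le_log_two_div_γ₂ (hm : 2 ≤ m) (hγ : γ ∈ Set.Ioo (0 : ℝ) 1) :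
    1 ≤ Real.log (2 / (params m γ ε).γ₂ m) := by
  obtain ⟨h0, h1⟩ := params_γ₂_mem (ε := ε) hm hγ
  rw [Real.le_log_iff_exp_le (by positivity), le_div_iff₀ h0]
  nlinarith [Real.exp_one_lt_d9, Real.exp_pos 1]

theorem log_one_add_δ_ge (hm : 2 ≤ m) (hε : ε ∈ Set.Ioo (0 : ℝ) 1) :
    (params m γ ε).δ m / 2 ≤ Real.log (1 + (params m γ ε).δ m) := by
  obtain ⟨h0, h1⟩ := params_δ_mem (γ := γ) hm hε
  have h := Real.one_sub_inv_le_log_of_pos (show 0 < 1 + (params m γ ε).δ m by linarith)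
  refine le_trans ?_ h
  rw [← sub_nonneg]
  have : 1 - (1 + (params m γ ε).δ m)⁻¹ - (params m γ ε).δ m / 2 =
      (params m γ ε).δ m * (1 - (params m γ ε).δ m) / (2 * (1 + (params m γ ε).δ m)) := by
    field_simp; ring
  rw [this]
  exact div_nonneg (mul_nonneg h0.le (by linarith)) (by linarith)

/-- The accuracy proof uses only the second summand of f₄; the first, with f₂ and v, only has to be
nonnegative here and reappears in the running time. -/
theorem le_params_f₄ (hm : 2 ≤ m) (hε : ε ∈ Set.Ioo (0 : ℝ) 1) :
    6 * Real.log (2 / (params m γ ε).γ₂ m) / (params m γ ε).ε₂ m ^ 3 ≤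
      (params m γ ε).f₄ m := by
  obtain ⟨h0, h1⟩ := params_ε₁_mem (γ := γ) hm hε
  have hl := one_le_logb_two hm
  have hδ := (params_δ_mem (γ := γ) hm hε).1
  have hlog := log_one_add_δ_ge (γ := γ) hm hε
  rw [params_f₄]
  refine le_add_of_nonneg_left (div_nonneg (mul_nonneg ?_ (Real.logb_nonneg (by norm_num) ?_))
    (by positivity))
  · have : 0 ≤ Real.logb 2 (1 + (params m γ ε).δ m) := Real.logb_nonneg (by norm_num) (by linarith)
    have := hε.1
    rw [params_f₂]
    positivity
  · rw [le_div_iff₀ h0]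
    have : (2 : ℝ) ≤ m := by exact_mod_cast hm
    nlinarith

theorem one_le_params_f₄ (hm : 2 ≤ m) (hγ : γ ∈ Set.Ioo (0 : ℝ) 1)
    (hε : ε ∈ Set.Ioo (0 : ℝ) 1) : 1 ≤ (params m γ ε).f₄ m := by
  refine le_trans ?_ (le_params_f₄ hm hε)
  obtain ⟨h0, h1⟩ := params_ε₁_mem (γ := γ) hm hε
  have hlog := one_le_log_two_div_γ₂ (ε := ε) hm hγ
  have h2 : (params m γ ε).ε₂ m = (params m γ ε).ε₁ m / 4 := rfl
  have h3 : 0 < (params m γ ε).ε₂ m := by rw [h2]; positivity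
  have h4 : (params m γ ε).ε₂ m ^ 3 ≤ 1 := pow_le_one₀ h3.le (by rw [h2]; linarith)
  rw [le_div_iff₀ (by positivity)]
  linarith

theorem one_le_params_f₅ (hm : 2 ≤ m) (hγ : γ ∈ Set.Ioo (0 : ℝ) 1)
    (hε : ε ∈ Set.Ioo (0 : ℝ) 1) : 1 ≤ (params m γ ε).f₅ m := by
  have h := one_le_params_f₄ hm hγ hε
  have : (2 : ℝ) ≤ m := by exact_mod_cast hm
  rw [params_f₅]
  nlinarith

theorem params_γ₃_mem (hm : 2 ≤ m) (hγ : γ ∈ Set.Ioo (0 : ℝ) 1) (hε : ε ∈ Set.Ioo (0 : ℝ) 1) :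
    (params m γ ε).γ₃ m ∈ Set.Ioc (0 : ℝ) 1 := by
  obtain ⟨h0, h1⟩ := params_γ₂_mem (ε := ε) hm hγ
  have h5 := one_le_params_f₅ hm hγ hε
  rw [Params.γ₃]
  refine ⟨by positivity, ?_⟩
  rw [div_le_one (by positivity)]
  linarith

theorem ceil_f₅_mul_γ₃_le (hm : 2 ≤ m) (hγ : γ ∈ Set.Ioo (0 : ℝ) 1)
    (hε : ε ∈ Set.Ioo (0 : ℝ) 1) :
    ⌈(params m γ ε).f₅ m⌉₊ * (params m γ ε).γ₃ m ≤ (params m γ ε).γ₂ m := by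
  obtain ⟨h0, h1⟩ := params_γ₂_mem (ε := ε) hm hγ
  have h5 := one_le_params_f₅ hm hγ hε
  have hc := (Nat.ceil_lt_add_one (show 0 ≤ (params m γ ε).f₅ m by linarith)).le
  -- The factor 2 in the definition of γ₃ absorbs the rounding: ⌈f₅⌉ ≤ f₅ + 1 ≤ 2f₅.
  rw [Params.γ₃, mul_div_assoc', div_le_iff₀ (by positivity), mul_comm]
  gcongr
  linarith

theorem log_two_div_γ₂_le (hm : 2 ≤ m) (hγ : γ ∈ Set.Ioo (0 : ℝ) 1)
    (hε : ε ∈ Set.Ioo (0 : ℝ) 1) :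
    Real.log (2 / (params m γ ε).γ₂ m) ≤
      (2 * (params m γ ε).ε₁ m) ^ 2 * (⌈(params m γ ε).f₅ m⌉₊ / m) / 4 := by
  obtain ⟨h0, h1⟩ := params_ε₁_mem (γ := γ) hm hε
  have hlog := one_le_log_two_div_γ₂ (ε := ε) hm hγ
  have hm0 : (0 : ℝ) < m := by positivity
  have hf := le_params_f₄ (γ := γ) hm hε
  have h4 : (params m γ ε).f₄ m ≤ ⌈(params m γ ε).f₅ m⌉₊ / m := by
    rw [le_div_iff₀ hm0, mul_comm, ← params_f₅]
    exact Nat.le_ceil _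
  have h2 : (params m γ ε).ε₂ m = (params m γ ε).ε₁ m / 4 := rfl
  rw [h2] at hf
  set e := (params m γ ε).ε₁ m
  set L := Real.log (2 / (params m γ ε).γ₂ m)
  -- Since ε₂ = e/4, the bound for f₄ is 6 · 64 L/e³; multiplication by (2e)²/4 = e² leaves 384 L/e,
  -- with ample room.
  calc L ≤ 384 * L / e := by
        rw [le_div_iff₀ h0]; nlinarith
    _ = (2 * e) ^ 2 * (6 * L / (e / 4) ^ 3) / 4 := by field_simp; ring
    _ ≤ _ := by linarith [mul_le_mul_of_nonneg_left (hf.trans h4) (sq_nonneg (2 * e))]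

theorem pow_stages_bounds (hm : 2 ≤ m) (hε : ε ∈ Set.Ioo (0 : ℝ) 1) :
    1 - ε ≤ (1 - 2 * (params m γ ε).ε₁ m) ^ (Nat.log 8 m + 2) ∧
      (1 + 2 * (params m γ ε).ε₁ m) ^ (Nat.log 8 m + 2) ≤ 1 + ε := by
  obtain ⟨h0, h1⟩ := params_ε₁_mem (γ := γ) hm hε
  have hl := one_le_logb_two hm
  have hJ := three_mul_log_eight_le m
  have hx : ((Nat.log 8 m + 2 : ℕ) : ℝ) * (2 * (params m γ ε).ε₁ m) ≤ ε / 2 := by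
    rw [params_ε₁]
    have h3 : ((Nat.log 8 m + 2 : ℕ) : ℝ) ≤ 3 * Real.logb 2 m := by push_cast; linarith
    have hε0 := hε.1
    calc _ ≤ 3 * Real.logb 2 m * (2 * (ε / (54 * Real.logb 2 m))) := by gcongr
      _ = ε / 9 := by field_simp; norm_num
      _ ≤ ε / 2 := by linarith
  set e := (params m γ ε).ε₁ m
  constructor
  -- Bernoulli's inequality below; in the other direction 1 + x ≤ exp x, followed by exp(ε/2) ≤ 1 +
  -- ε/2 + ε²/4.
  · have := one_add_mul_le_pow (show -2 ≤ -(2 * e) by linarith) (Nat.log 8 m + 2)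
    rw [← sub_eq_add_neg 1 (2 * e)] at this
    linarith [hε.1]
  · calc (1 + 2 * e) ^ (Nat.log 8 m + 2) ≤ Real.exp (2 * e) ^ (Nat.log 8 m + 2) := by
          gcongr
          linarith [Real.add_one_le_exp (2 * e)]
      _ = Real.exp ((Nat.log 8 m + 2 : ℕ) * (2 * e)) := by rw [← Real.exp_nat_mul]
      _ ≤ Real.exp (ε / 2) := Real.exp_le_exp.2 hx
      _ ≤ 1 + ε := by
          have h := exp_sub_one_le (t := ε / 2) (by
            rw [abs_of_pos (by linarith [hε.1])]; linarith [hε.2])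
          nlinarith [hε.1, hε.2]

theorem failure_le (hm : 2 ≤ m) (hγ : γ ∈ Set.Ioo (0 : ℝ) 1) :
    ENNReal.ofReal ((params m γ ε).γ₂ m) +
      (Nat.log 8 m + 1 : ℕ) * (2 * ENNReal.ofReal ((params m γ ε).γ₂ m)) ≤
      ENNReal.ofReal γ := by
  have h0 := (params_γ₂_mem (ε := ε) hm hγ).1
  have hl := one_le_logb_two hm
  have hJ := three_mul_log_eight_le m
  have h2 : (2 : ℝ≥0∞) = ENNReal.ofReal 2 := by simp
  rw [← ENNReal.ofReal_natCast, h2, ← ENNReal.ofReal_mul (by norm_num),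
    ← ENNReal.ofReal_mul (by positivity), ← ENNReal.ofReal_add h0.le (by positivity)]
  refine ENNReal.ofReal_le_ofReal ?_
  rw [params_γ₂]
  have hγ0 := hγ.1
  have h3 : 1 + 2 * ((Nat.log 8 m + 1 : ℕ) : ℝ) ≤ 6 * Real.logb 2 m := by push_cast; linarith
  calc _ = (1 + 2 * ((Nat.log 8 m + 1 : ℕ) : ℝ)) * (γ / (6 * Real.logb 2 m)) := by ring
    _ ≤ 6 * Real.logb 2 m * (γ / (6 * Real.logb 2 m)) := by gcongr
    _ = γ := by field_simp

end Parameters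

theorem ofReal_one_sub_le_toOuterMeasure {α : Type u} (p : PMF α) (E : Set α) {c : ℝ} (hc : 0 ≤ c)
    (h : p.toOuterMeasure Eᶜ ≤ ENNReal.ofReal c) : ENNReal.ofReal (1 - c) ≤ p.toOuterMeasure E := by
  have h1 : (1 : ℝ≥0∞) ≤ p.toOuterMeasure E + p.toOuterMeasure Eᶜ := by
    rw [← (p.toOuterMeasure_apply_eq_one_iff (s := Set.univ)).2 (Set.subset_univ _),
      ← Set.union_compl_self E]
    exact MeasureTheory.measure_union_le _ _
  rw [ENNReal.ofReal_sub _ hc, ENNReal.ofReal_one]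
  exact tsub_le_iff_right.2 (h1.trans (add_le_add le_rfl h))

theorem approximateUnion_accurate {m : ℕ} [NeZero m] {U : Type u} [DecidableEq U]
    {αL αR βL βR γ ε : ℝ} (L : ApproxList m U αL αR βL βR) (hm : 2 ≤ m) (hαL : αL < 1)
    (hβL : βL < 1) (hβR : 0 ≤ βR) (hγ : γ ∈ Set.Ioo (0 : ℝ) 1)
    (hε : ε ∈ Set.Ioo (0 : ℝ) 1) :
    ENNReal.ofReal (1 - γ) ≤
      ((approximateUnion (params m γ ε) L.size (∑ i, L.size i)).exec L.A L.gen).toOuterMeasure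
        {o | (1 - ε) * (1 - αL) * (1 - βL) * ((Finset.univ.biUnion L.A).card : ℝ) ≤ o.value ∧
          o.value ≤ (1 + ε) * (1 + αR) * (1 + βR) * ((Finset.univ.biUnion L.A).card : ℝ)} := by
  have hf5 := one_le_params_f₅ hm hγ hε
  obtain ⟨he₀, he⟩ := params_ε₁_mem (γ := γ) hm hε
  obtain ⟨hg₃₀, hg₃⟩ := params_γ₃_mem hm hγ hε
  have key := (law_approximateUnion_le L (params m γ ε) hβL rfl rfl rfl he₀ (by linarith)
    (params_γ₂_mem (ε := ε) hm hγ).1 hg₃₀ hg₃ hm (Nat.ceil_pos.2 (by linarith))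
    (ceil_f₅_mul_γ₃_le hm hγ hε) params_f₆ (log_two_div_γ₂_le hm hγ hε)).trans
    (failure_le hm hγ)
  rw [Alg.law, PMF.toOuterMeasure_map_apply] at key
  refine ofReal_one_sub_le_toOuterMeasure _ _ hγ.1.le
    (le_trans (MeasureTheory.measure_mono fun o ho => ?_) key)
  obtain ⟨hp1, hp2⟩ := pow_stages_bounds (γ := γ) hm hε
  have hM := L.sum_size_pos hβL
  have hmean₀ : 0 ≤ L.mean := le_trans (by positivity) (L.one_div_le_mean hβL)
  have hl := L.le_mean_mul hαL hβL
  have hu := L.mean_mul_le hβL hβR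
  simp only [Set.mem_compl_iff, Set.mem_ofPred_eq, Set.mem_preimage] at ho ⊢
  contrapose! ho
  refine ⟨le_trans ?_ ho.1, ho.2.trans ?_⟩
  · calc _ = (1 - ε) * ((1 - αL) * (1 - βL) * ((Finset.univ.biUnion L.A).card : ℝ)) := by ring
      _ ≤ _ := mul_le_mul hp1 hl (mul_nonneg (mul_nonneg (by linarith) (by linarith))
          (by positivity)) (pow_nonneg (by linarith) _)
  · calc _ ≤ (1 + ε) * ((1 + αR) * (1 + βR) * ((Finset.univ.biUnion L.A).card : ℝ)) :=
          mul_le_mul hp2 hu (mul_nonneg hmean₀ hM.le) (by linarith [hε.1])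
      _ = _ := by ring

/-! ### Worst-case time and rounds -/

section Cost

/-- The cost of a stage is bounded as long as the list of samples is short enough for the current
thickness. -/
theorem stage_cost_le {m : ℕ} {h₁ f ct : ℝ} (hf : 0 ≤ f) (hh₁ : 0 ≤ h₁) (h1 : 1 ≤ ct) (hm : ct ≤ m)
    {r k h : ℕ} (hr : (r : ℝ) ≤ h₁ / (m / ct) + 1) (hk : (k : ℝ) ≤ m / ct * f + 1)
    (hh : (h : ℝ) ≤ h₁) :
    3 + (k : ℝ) + 2 * (r * k) + 3 * r + h ≤ h₁ * (2 * f + 6) + 3 * (m * f) + 9 := by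
  have hct : 0 < ct := by linarith
  have hm0 : (0 : ℝ) < m := by linarith
  have e1 : (m : ℝ) / ct * f ≤ m * f := by
    gcongr; exact div_le_self hm0.le h1
  have e2 : h₁ / (m / ct) ≤ h₁ := div_le_self hh₁ ((one_le_div hct).2 hm)
  -- The thickness cancels in the main term of the product; the other terms come from rounding up.
  have e3 : (r : ℝ) * k ≤ h₁ * f + h₁ + m * f + 1 := by
    calc (r : ℝ) * k ≤ (h₁ / (m / ct) + 1) * (m / ct * f + 1) := by gcongr
      _ = h₁ * f + h₁ / (m / ct) + m / ct * f + 1 := by field_simp; ring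
      _ ≤ _ := by linarith
  linarith

variable {m : ℕ} [NeZero m] {U : Type u} [DecidableEq U]
  {A : Fin m → Finset U} {gen : Fin m → PMF U}

theorem bounded_randomSamples (R : List U) (n : ℕ) :
    (randomSamples R n : Alg m U (List U)).Bounded A gen n 0 fun l => l.length ≤ n := by
  cases R with
  | nil =>
    exact (Alg.bounded_ret (Q := fun l : List U => l.length ≤ n) (by simp)).mono (by simp) le_rfl
      fun _ h => h
  | cons x l =>
    rw [randomSamples]
    refine (Alg.Bounded.iterate (t := 1) (Alg.bounded_uniform (t := 0) fun i =>
      Alg.bounded_ret trivial) n).mono (by simp) le_rfl fun l hl => hl.le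

/-- No good event is needed: the algorithm itself keeps the next list at length at most h, by
resampling whenever more elements remain. The bound on the length of R is therefore an invariant of
every run, and each stage costs at most the same W. -/
theorem bounded_stages (p : Params) (hf₁ : p.f₁ = 8) (hz : p.zmin = 1) (M : ℝ) (h₁ : ℕ)
    (hf : 0 ≤ p.f₆ m) {W : ℕ} (hW : h₁ * (2 * p.f₆ m + 6) + 3 * (m * p.f₆ m) + 9 ≤ W) (j : ℕ) :
    ∀ (n : ℕ) (ct wt sum : ℝ) (R : List U), j ≤ n → 1 ≤ ct → ct < 8 ^ j → ct ≤ m →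
      (R.length : ℝ) ≤ h₁ / (m / ct) + 1 →
      (stages p M h₁ n ct wt sum R : Alg m U ℝ).Bounded A gen (j * W) j fun _ => True := by
  induction j with
  | zero =>
    intro n ct wt sum R _ h1 h2
    rw [pow_zero] at h2
    exact absurd h1 (not_le.2 h2)
  | succ j ih =>
    intro n ct wt sum R hn hct hct' hctm hR
    obtain ⟨n, rfl⟩ : ∃ n', n = n' + 1 := ⟨n - 1, by omega⟩
    have hct₀ : 0 < ct := by linarith
    have hm0 : (0 : ℝ) < m := by linarith
    rw [stages]
    simp only [hf₁, hz, Nat.cast_one]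
    set k : ℕ := ⌈(m : ℝ) / ct * p.f₆ m⌉₊ with hk
    set h : ℕ := ⌈(h₁ : ℝ) / (m / (ct / 8))⌉₊ with hh
    have hk' : (k : ℝ) ≤ m / ct * p.f₆ m + 1 := (Nat.ceil_lt_add_one (by positivity)).le
    have hh' : (h : ℝ) ≤ h₁ := by
      have : h ≤ h₁ := by
        rw [hh, Nat.ceil_le]
        exact div_le_self (by positivity) ((one_le_div (by positivity)).2 (by linarith))
      exact_mod_cast this
    have hh'' : (h : ℝ) ≤ h₁ / (m / (ct / 8)) + 1 := (Nat.ceil_lt_add_one (by positivity)).le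
    have hcost : 3 + k + 2 * (R.length * k) + 3 * R.length + h ≤ W := by
      have := (stage_cost_le hf (Nat.cast_nonneg h₁) hct hctm hR hk' hh').trans hW
      exact_mod_cast this
    have hiter : (Alg.iterate (randomIndex : Alg m U (Fin m)) k).Bounded A gen (k * 1) 0
        fun H => H.length = k :=
      Alg.Bounded.iterate (Alg.bounded_uniform (t := 0) fun i => Alg.bounded_ret trivial) k
    -- The budget: k index draws, |R|k queries, |R|k + 3|R| + 1 local steps for counting and
    -- filtering, h resampling draws, and a unit step at either end of the stage.
    refine Alg.Bounded.mono (Alg.Bounded.step (hiter.bind (t' := R.length * k +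
      (R.length * k + 3 * R.length + 1) + h + 1 + j * W) (r' := j + 1) (Q' := fun _ => True)
      fun H hH => ?_) 1) (t' := (j + 1) * W) (r' := j + 1) ?_ (by omega) fun _ h => h
    swap
    · rw [add_mul, one_mul]
      linarith
    refine Alg.Bounded.mono (Alg.bounded_round (t := (h + (1 + j * W)) +
      (R.length * k + 3 * R.length + 1)) (r := j) (P := fun _ => True) fun xs a _ => ?_)
      (by simp only [List.length_nil, List.length_product, hH]; omega) le_rfl fun _ h => h
    have hrlen := List.length_filter_le (fun x => decide ¬ ct / (2 * 8 * m) * k ≤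
      ((List.countP (a x) H : ℕ) : ℝ)) R
    have hVlen := List.length_filter_le (fun x => decide (ct / (2 * 8 * m) * k ≤
      ((List.countP (a x) H : ℕ) : ℝ))) R
    refine Alg.Bounded.mono (Alg.Bounded.step (Alg.Bounded.bind (t := h) (r := 0)
      (t' := 1 + j * W) (r' := j) (Q := fun q => (q.1.length : ℝ) ≤ h) ?_
      fun q hq => ?_) _) (by rw [hH]; omega) (Nat.zero_add j).le fun _ h => h
    · split_ifs with hlt
      · exact (Alg.bounded_ret (Q := fun q : List U × ℝ => (q.1.length : ℝ) ≤ h)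
          (by exact_mod_cast hlt.le)).mono (Nat.zero_le _) le_rfl fun _ h => h
      · exact (bounded_randomSamples _ h).bind (t' := 0) (r' := 0) fun l hl =>
          Alg.bounded_ret (by exact_mod_cast hl)
    · refine Alg.Bounded.mono (Alg.Bounded.step (t := j * W) (r := j) (Q := fun _ => True) ?_ 1)
        (by omega) le_rfl fun _ h => h
      split_ifs with hend
      · exact (Alg.bounded_ret trivial).mono (Nat.zero_le _) (Nat.zero_le _) fun _ h => h
      · push Not at hend
        exact ih n (ct / 8) _ _ _ (by omega) hend (by rw [pow_succ] at hct'; linarith)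
          (by linarith) (hq.trans hh'')

theorem bounded_approximateUnion (p : Params) (hf₁ : p.f₁ = 8) (hz : p.zmin = 1)
    (hz' : p.zmax = m) (size : Fin m → ℝ) (M : ℝ) (hf : 0 ≤ p.f₆ m) {W : ℕ}
    (hW : ⌈p.f₅ m⌉₊ * (2 * p.f₆ m + 6) + 3 * (m * p.f₆ m) + 9 ≤ W) :
    (approximateUnion p size M : Alg m U ℝ).Bounded A gen
      (m + 1 + ⌈p.f₅ m⌉₊ * (Nat.clog 2 m + 2) + (Nat.log 8 m + 1) * W) (Nat.log 8 m + 2)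
      fun _ => True := by
  have hm0 : (0 : ℝ) < m := Nat.cast_pos.2 (NeZero.pos m)
  have hpow : m < 8 ^ (Nat.log 8 m + 1) := Nat.lt_pow_succ_log_self (by norm_num) m
  rw [approximateUnion]
  set h₁ := ⌈p.f₅ m⌉₊
  have hiter : (Alg.iterate (randomSet size : Alg m U (Fin m)) h₁).Bounded A gen
      (h₁ * (0 + Nat.clog 2 m + 1)) 0 fun I => I.length = h₁ :=
    Alg.Bounded.iterate (Alg.bounded_weighted fun i => (Alg.bounded_ret trivial).step _) h₁
  refine Alg.Bounded.mono ((hiter.bind (t' := (Nat.log 8 m + 1) * W + (h₁ + 0))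
    (r' := Nat.log 8 m + 1 + 1) (Q' := fun _ => True) fun I hI => ?_).step (m + 1))
    (le_of_eq (by ring)) (by omega) fun _ h => h
  have hround := Alg.bounded_round (A := A) (gen := gen) (I := I) (Q := [])
    (next := fun R _ => stages p M h₁ m p.zmax (1 / h₁) 0 R) (t := (Nat.log 8 m + 1) * W)
    (r := Nat.log 8 m + 1) (P := fun _ => True) fun xs a hxs =>
    bounded_stages p hf₁ hz M h₁ hf hW (Nat.log 8 m + 1) m p.zmax (1 / h₁) 0 xs
      (Nat.log_lt_self 8 (NeZero.ne m))
      (by rw [hz']; exact_mod_cast NeZero.pos m) (by rw [hz']; exact_mod_cast hpow) (by rw [hz'])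
      (by rw [hz', div_self hm0.ne', div_one, hxs, hI]; linarith)
  rw [hI] at hround
  exact hround

end Cost

/-! ### Functions of polynomial growth -/

section Domination

variable {ι : Type u} {X : ι → ℝ}

/-- The function `f` is bounded by a constant multiple of a power of `X`. -/
def PolyDominated (X f : ι → ℝ) : Prop := ∃ (c : ℝ) (a : ℕ), 0 ≤ c ∧ ∀ i, |f i| ≤ c * X i ^ a

theorem PolyDominated.const (c : ℝ) : PolyDominated X fun _ => c :=
  ⟨|c|, 0, abs_nonneg c, fun i => by simp⟩

theorem PolyDominated.of_abs_le {f g : ι → ℝ} (hg : PolyDominated X g) (h : ∀ i, |f i| ≤ g i) :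
    PolyDominated X f := by
  obtain ⟨c, a, hc, hca⟩ := hg
  exact ⟨c, a, hc, fun i => (h i).trans ((le_abs_self _).trans (hca i))⟩

theorem PolyDominated.self (hX : ∀ i, 1 ≤ X i) : PolyDominated X X :=
  ⟨1, 1, zero_le_one, fun i => by rw [abs_of_nonneg (by linarith [hX i])]; simp⟩

theorem PolyDominated.mul (hX : ∀ i, 1 ≤ X i) {f g : ι → ℝ} (hf : PolyDominated X f)
    (hg : PolyDominated X g) : PolyDominated X fun i => f i * g i := by
  obtain ⟨c, a, hc, hf⟩ := hf
  obtain ⟨d, b, hd, hg⟩ := hg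
  refine ⟨c * d, a + b, by positivity, fun i => ?_⟩
  have h0 : 0 ≤ X i := by linarith [hX i]
  rw [abs_mul]
  calc _ ≤ (c * X i ^ a) * (d * X i ^ b) := mul_le_mul (hf i) (hg i) (abs_nonneg _) (by positivity)
    _ = _ := by ring

theorem PolyDominated.add (hX : ∀ i, 1 ≤ X i) {f g : ι → ℝ} (hf : PolyDominated X f)
    (hg : PolyDominated X g) : PolyDominated X fun i => f i + g i := by
  obtain ⟨c, a, hc, hf⟩ := hf
  obtain ⟨d, b, hd, hg⟩ := hg
  refine ⟨c + d, a + b, by positivity, fun i => (abs_add_le _ _).trans ?_⟩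
  have h1 : X i ^ a ≤ X i ^ (a + b) := pow_le_pow_right₀ (hX i) (by omega)
  have h2 : X i ^ b ≤ X i ^ (a + b) := pow_le_pow_right₀ (hX i) (by omega)
  calc _ ≤ c * X i ^ a + d * X i ^ b := add_le_add (hf i) (hg i)
    _ ≤ c * X i ^ (a + b) + d * X i ^ (a + b) := by gcongr
    _ = _ := by ring

theorem PolyDominated.pow (hX : ∀ i, 1 ≤ X i) {f : ι → ℝ} (hf : PolyDominated X f) (n : ℕ) :
    PolyDominated X fun i => f i ^ n := by
  induction n with
  | zero => simpa using PolyDominated.const 1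
  | succ n ih =>
    simp only [pow_succ]
    exact ih.mul hX hf

/-- The crude bound log f ≤ f − 1 is enough, since the exponents of the final polynomial are not
tracked. -/
theorem PolyDominated.log {f : ι → ℝ} (hf : PolyDominated X f) (h1 : ∀ i, 1 ≤ f i) :
    PolyDominated X fun i => Real.log (f i) :=
  hf.of_abs_le fun i => by
    rw [abs_of_nonneg (Real.log_nonneg (h1 i))]
    linarith [Real.log_le_sub_one_of_pos (show 0 < f i by linarith [h1 i])]

end Domination

/-! ### The running time per set is polynomially bounded -/

section RunningTime

/-- The inputs of the running time bound: the number of sets and the accuracy parameters. -/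
def Input : Type :=
  {q : ℕ × ℝ × ℝ // 2 ≤ q.1 ∧ q.2.1 ∈ Set.Ioo (0 : ℝ) 1 ∧ q.2.2 ∈ Set.Ioo (0 : ℝ) 1}

namespace Input

/-- The number of sets. -/
def m (q : Input) : ℕ := q.1.1
/-- The failure probability. -/
def γ (q : Input) : ℝ := q.1.2.1
/-- The accuracy. -/
def ε (q : Input) : ℝ := q.1.2.2
/-- The parameters of the algorithm for this input. -/
noncomputable def p (q : Input) : Params := params q.m q.γ q.ε
/-- The binary logarithm of the number of sets. -/
noncomputable def ℓ (q : Input) : ℝ := Real.logb 2 q.m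
/-- The quantity with polynomial powers that bound the running time per set. -/
noncomputable def X (q : Input) : ℝ := 1 / q.ε * (1 + Real.log (1 / q.γ)) * q.ℓ

variable (q : Input)

theorem two_le_m : 2 ≤ q.m := q.2.1
theorem γ_mem : q.γ ∈ Set.Ioo (0 : ℝ) 1 := q.2.2.1
theorem ε_mem : q.ε ∈ Set.Ioo (0 : ℝ) 1 := q.2.2.2
theorem one_le_ℓ : 1 ≤ q.ℓ := one_le_logb_two q.two_le_m
theorem one_le_inv_ε : 1 ≤ 1 / q.ε := (one_le_div q.ε_mem.1).2 q.ε_mem.2.le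
theorem log_γ_nonneg : 0 ≤ Real.log (1 / q.γ) :=
  Real.log_nonneg ((one_le_div q.γ_mem.1).2 q.γ_mem.2.le)

theorem one_le_X : 1 ≤ q.X :=
  one_le_mul_of_one_le_of_one_le
    (one_le_mul_of_one_le_of_one_le q.one_le_inv_ε (by linarith [q.log_γ_nonneg])) q.one_le_ℓ

theorem dominated_ℓ : PolyDominated X ℓ :=
  (PolyDominated.self one_le_X).of_abs_le fun q => by
    rw [abs_of_nonneg (by linarith [q.one_le_ℓ])]
    exact le_mul_of_one_le_left (by linarith [q.one_le_ℓ])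
      (one_le_mul_of_one_le_of_one_le q.one_le_inv_ε (by linarith [q.log_γ_nonneg]))

theorem dominated_inv_ε : PolyDominated X fun q => 1 / q.ε :=
  (PolyDominated.self one_le_X).of_abs_le fun q => by
    rw [abs_of_nonneg (by linarith [q.one_le_inv_ε]), X, mul_assoc]
    exact le_mul_of_one_le_right (by linarith [q.one_le_inv_ε])
      (one_le_mul_of_one_le_of_one_le (by linarith [q.log_γ_nonneg]) q.one_le_ℓ)

theorem dominated_log_γ : PolyDominated X fun q => Real.log (1 / q.γ) :=
  (PolyDominated.self one_le_X).of_abs_le fun q => by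
    rw [abs_of_nonneg q.log_γ_nonneg, X]
    have h1 := q.one_le_inv_ε
    have h2 := q.one_le_ℓ
    have h3 := q.log_γ_nonneg
    calc _ ≤ 1 * (1 + Real.log (1 / q.γ)) * 1 := by linarith
      _ ≤ _ := by gcongr

theorem dominated_inv_ε₁ : PolyDominated X fun q => 1 / q.p.ε₁ q.m :=
  ((PolyDominated.const 54).mul one_le_X (dominated_ℓ.mul one_le_X dominated_inv_ε)).of_abs_le
    fun q => le_of_eq <| by
      rw [p, abs_of_nonneg (one_div_nonneg.2 (params_ε₁_mem q.two_le_m q.ε_mem).1.le), params_ε₁, ℓ]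
      simp only [one_div_div]
      ring

/-- As δ = ε₁/8 and log(1 + δ) ≥ δ/2, the reciprocal is at most 16/ε₁. -/
theorem dominated_inv_log_one_add_δ :
    PolyDominated X fun q => 1 / Real.log (1 + q.p.δ q.m) :=
  ((PolyDominated.const 16).mul one_le_X dominated_inv_ε₁).of_abs_le fun q => by
    have h0 := (params_δ_mem (γ := q.γ) q.two_le_m q.ε_mem).1
    have h := log_one_add_δ_ge (γ := q.γ) q.two_le_m q.ε_mem
    rw [p, abs_of_nonneg (one_div_nonneg.2 (le_trans (by positivity) h))]
    refine (one_div_le_one_div_of_le (by positivity) h).trans (le_of_eq ?_)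
    rw [Params.δ, Params.ε₂]
    field_simp; norm_num

theorem log_two_pos : 0 < Real.log 2 := Real.log_pos (by norm_num)

theorem dominated_log_m : PolyDominated X fun q => Real.log q.m :=
  ((PolyDominated.const (Real.log 2)).mul one_le_X dominated_ℓ).of_abs_le fun q => by
    rw [abs_of_nonneg (Real.log_natCast_nonneg _), ℓ, Real.logb, mul_div_cancel₀ _ log_two_pos.ne']

theorem dominated_v : PolyDominated X fun q => (q.p.v q.m : ℝ) :=
  ((dominated_log_m.mul one_le_X dominated_inv_log_one_add_δ).add one_le_X
    (PolyDominated.const 1)).of_abs_le fun q => by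
    have h0 := (params_δ_mem (γ := q.γ) q.two_le_m q.ε_mem).1
    have h1 : 0 ≤ Real.log q.m / Real.log (1 + q.p.δ q.m) :=
      div_nonneg (Real.log_natCast_nonneg _) (Real.log_nonneg (by rw [p]; linarith))
    have h2 : q.p.v q.m = ⌊Real.log q.m / Real.log (1 + q.p.δ q.m)⌋₊ + 1 := by
      simp [Params.v, p, params]
    rw [abs_of_nonneg (Nat.cast_nonneg _), h2, Nat.cast_add, Nat.cast_one, mul_one_div]
    linarith [Nat.floor_le h1]

theorem dominated_f₂ : PolyDominated X fun q => q.p.f₂ q.m := by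
  have h : ∀ q : Input, q.p.f₂ q.m = 54 * ((q.p.v q.m : ℝ) * (1 / q.ε)) +
      54 * Real.log 2 * (q.ℓ * (1 / q.ε * (1 / Real.log (1 + q.p.δ q.m)))) := by
    intro q
    have h : Real.logb 2 (1 + q.p.δ q.m) = Real.log (1 + q.p.δ q.m) / Real.log 2 := rfl
    rw [p] at h ⊢
    rw [params_f₂, h, ℓ]
    have := log_two_pos
    field_simp
    ring
  simp only [h]
  exact ((PolyDominated.const _).mul one_le_X (dominated_v.mul one_le_X dominated_inv_ε)).add
    one_le_X ((PolyDominated.const _).mul one_le_X (dominated_ℓ.mul one_le_X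
      (dominated_inv_ε.mul one_le_X dominated_inv_log_one_add_δ)))

theorem dominated_log_two_div_γ₂ : PolyDominated X fun q => Real.log (2 / q.p.γ₂ q.m) := by
  have h : ∀ q : Input, Real.log (2 / q.p.γ₂ q.m) =
      Real.log (12 * q.ℓ) + Real.log (1 / q.γ) := by
    intro q
    have h1 := q.one_le_ℓ
    have h2 := q.γ_mem.1
    rw [← Real.log_mul (by positivity) (by positivity), p, params_γ₂]
    congr 1
    rw [ℓ]
    field_simp; ring
  simp only [h]
  exact (((PolyDominated.const _).mul one_le_X dominated_ℓ).log
    fun q => by linarith [q.one_le_ℓ]).add one_le_X dominated_log_γ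

theorem dominated_f₄ : PolyDominated X fun q => q.p.f₄ q.m := by
  have h : ∀ q : Input, q.p.f₄ q.m = q.p.f₂ q.m *
      ((2 * Real.log q.m + Real.log (1 / q.p.ε₁ q.m)) *
        (1 / (6 * Real.log 2) * (1 / q.p.ε₁ q.m) ^ 2)) +
      384 * (Real.log (2 / q.p.γ₂ q.m) * (1 / q.p.ε₁ q.m) ^ 3) := by
    intro q
    have h0 := (params_ε₁_mem (γ := q.γ) q.two_le_m q.ε_mem).1
    have hm : (0 : ℝ) < q.m := by have := q.two_le_m; positivity
    rw [p, params_f₄, Real.logb, div_eq_mul_one_div ((q.m : ℝ) ^ 2),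
      Real.log_mul (by positivity) (by positivity), Real.log_pow, Params.ε₂]
    have := log_two_pos
    push_cast
    field_simp
    ring
  simp only [h]
  refine (dominated_f₂.mul one_le_X (PolyDominated.mul one_le_X
    (((PolyDominated.const _).mul one_le_X dominated_log_m).add one_le_X
      (dominated_inv_ε₁.log fun q => ?_))
    ((PolyDominated.const _).mul one_le_X (dominated_inv_ε₁.pow one_le_X 2)))).add one_le_X
    ((PolyDominated.const _).mul one_le_X (dominated_log_two_div_γ₂.mul one_le_X
      (dominated_inv_ε₁.pow one_le_X 3)))
  have h0 := params_ε₁_mem (γ := q.γ) q.two_le_m q.ε_mem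
  exact (one_le_div h0.1).2 (by linarith [h0.2])

/-- Although 1/γ₃ contains the factor m, which no power of X need dominate, the logarithm turns it
into the summand log m. -/
theorem dominated_log_two_div_γ₃ : PolyDominated X fun q => Real.log (2 / q.p.γ₃ q.m) := by
  have h : ∀ q : Input, Real.log (2 / q.p.γ₃ q.m) =
      Real.log q.m + (Real.log (2 * q.p.f₄ q.m) + Real.log (2 / q.p.γ₂ q.m)) := by
    intro q
    have h0 := (params_γ₂_mem (ε := q.ε) q.two_le_m q.γ_mem).1
    have hm : (0 : ℝ) < q.m := by have := q.two_le_m; positivity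
    have h4 := one_le_params_f₄ q.two_le_m q.γ_mem q.ε_mem
    rw [p, ← Real.log_mul (by positivity) (by positivity),
      ← Real.log_mul (by positivity) (by positivity), Params.γ₃, params_f₅]
    congr 1
    field_simp
  simp only [h]
  refine dominated_log_m.add one_le_X (PolyDominated.add one_le_X
    (((PolyDominated.const _).mul one_le_X dominated_f₄).log fun q => ?_) dominated_log_two_div_γ₂)
  have h4 := one_le_params_f₄ q.two_le_m q.γ_mem q.ε_mem
  rw [p]; linarith

theorem dominated_f₆ : PolyDominated X fun q => q.p.f₆ q.m := by
  have h : ∀ q : Input, q.p.f₆ q.m =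
      192 * ((1 / q.p.ε₁ q.m) ^ 2 * Real.log (2 / q.p.γ₃ q.m)) := by
    intro q
    rw [p, params_f₆]; ring
  simp only [h]
  exact (PolyDominated.const _).mul one_le_X
    ((dominated_inv_ε₁.pow one_le_X 2).mul one_le_X dominated_log_two_div_γ₃)

/-- A bound for the running time per set. -/
noncomputable def timeBound (q : Input) : ℝ :=
  2 + (q.p.f₄ q.m + 1) * (q.ℓ + 3) +
    (q.ℓ + 1) * ((q.p.f₄ q.m + 1) * (2 * q.p.f₆ q.m + 6) + (3 * q.p.f₆ q.m + 10))

theorem dominated_timeBound : PolyDominated X timeBound := by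
  have c : ∀ c : ℝ, PolyDominated X fun _ => c := PolyDominated.const
  exact ((c 2).add one_le_X ((dominated_f₄.add one_le_X (c 1)).mul one_le_X
    (dominated_ℓ.add one_le_X (c 3)))).add one_le_X ((dominated_ℓ.add one_le_X (c 1)).mul one_le_X
    (((dominated_f₄.add one_le_X (c 1)).mul one_le_X
      (((c 2).mul one_le_X dominated_f₆).add one_le_X (c 6))).add one_le_X
      (((c 3).mul one_le_X dominated_f₆).add one_le_X (c 10))))

theorem f₆_nonneg : 0 ≤ q.p.f₆ q.m := by
  obtain ⟨h0, h1⟩ := params_γ₃_mem q.two_le_m q.γ_mem q.ε_mem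
  have : 0 ≤ Real.log (2 / (params q.m q.γ q.ε).γ₃ q.m) :=
    Real.log_nonneg ((one_le_div h0).2 (by linarith))
  rw [p, params_f₆]
  positivity

theorem cost_le (W : ℕ)
    (hW : W ≤ ⌈q.p.f₅ q.m⌉₊ * (2 * q.p.f₆ q.m + 6) + 3 * (q.m * q.p.f₆ q.m) + 9 + 1) :
    ((q.m + 1 + ⌈q.p.f₅ q.m⌉₊ * (Nat.clog 2 q.m + 2) + (Nat.log 8 q.m + 1) * W : ℕ) : ℝ) ≤
      q.timeBound * q.m := by
  have hm : (2 : ℝ) ≤ q.m := by exact_mod_cast q.two_le_m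
  have h5 := one_le_params_f₅ q.two_le_m q.γ_mem q.ε_mem
  have h4 := one_le_params_f₄ q.two_le_m q.γ_mem q.ε_mem
  have hl := q.one_le_ℓ
  have hJ : (Nat.log 8 q.m : ℝ) ≤ q.ℓ := by
    have := three_mul_log_eight_le q.m
    rw [ℓ] at hl ⊢
    linarith
  have hc : (Nat.clog 2 q.m : ℝ) ≤ q.ℓ + 1 := by
    have h1 : Nat.clog 2 q.m ≤ Nat.log 2 q.m + 1 :=
      Nat.clog_le_of_le_pow (Nat.lt_pow_succ_log_self (by norm_num) _).le
    have h2 := Real.natLog_le_logb q.m 2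
    have h3 : (Nat.clog 2 q.m : ℝ) ≤ Nat.log 2 q.m + 1 := by exact_mod_cast h1
    have h4 : Real.logb (2 : ℕ) q.m = q.ℓ := by rw [ℓ, Nat.cast_ofNat]
    linarith
  have hh : (⌈q.p.f₅ q.m⌉₊ : ℝ) ≤ q.m * (q.p.f₄ q.m + 1) := by
    have := (Nat.ceil_lt_add_one (show 0 ≤ (params q.m q.γ q.ε).f₅ q.m by linarith)).le
    rw [p]
    refine this.trans ?_
    rw [params_f₅]
    linarith
  have h6 := q.f₆_nonneg
  push_cast
  rw [timeBound]
  have h4' : 1 ≤ q.p.f₄ q.m := h4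
  set f := q.p.f₆ q.m
  set F := q.p.f₄ q.m
  set μ : ℝ := (q.m : ℝ)
  have hW' : (W : ℝ) ≤ μ * ((F + 1) * (2 * f + 6) + (3 * f + 10)) := by
    refine hW.trans ?_
    have : (⌈q.p.f₅ q.m⌉₊ : ℝ) * (2 * f + 6) ≤ μ * (F + 1) * (2 * f + 6) := by gcongr
    linarith
  calc μ + 1 + (⌈q.p.f₅ q.m⌉₊ : ℝ) * (Nat.clog 2 q.m + 2) + (Nat.log 8 q.m + 1) * W
      ≤ μ + μ + μ * (F + 1) * (q.ℓ + 1 + 2) +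
        (q.ℓ + 1) * (μ * ((F + 1) * (2 * f + 6) + (3 * f + 10))) := by gcongr; linarith
    _ = _ := by ring

end Input

end RunningTime

end SetUnion

theorem mainTheorem2 :
    ∃ (P : MvPolynomial (Fin 2) ℝ) (k : ℕ) (C : ℝ),
      ∀ (m : ℕ) [NeZero m] (U : Type*) [DecidableEq U] (αL αR βL βR γ ε : ℝ),
        2 ≤ m →
        αL ∈ Set.Ico (0 : ℝ) 1 → αR ∈ Set.Ico (0 : ℝ) 1 →
        βL ∈ Set.Ico (0 : ℝ) 1 → βR ∈ Set.Ico (0 : ℝ) 1 →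
        γ ∈ Set.Ioo (0 : ℝ) 1 → ε ∈ Set.Ioo (0 : ℝ) 1 →
        ∀ L : SetUnion.ApproxList m U αL αR βL βR,
          let run : PMF (SetUnion.Outcome ℝ) :=
            (SetUnion.approximateUnion ⟨8, 1, m, γ, ε⟩ L.size (∑ i, L.size i)).exec L.A L.gen
          let N : ℝ := ((Finset.univ.biUnion L.A).card : ℝ)
          (∀ o ∈ run.support,
            (o.time : ℝ) ≤
                MvPolynomial.eval ![1 / ε, Real.log (1 / γ)] P * m * Real.logb 2 m ^ k ∧
              (o.rounds : ℝ) ≤ C * Real.logb 2 m) ∧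
          ENNReal.ofReal (1 - γ) ≤ run.toOuterMeasure
            {o | (1 - ε) * (1 - αL) * (1 - βL) * N ≤ o.value ∧
              o.value ≤ (1 + ε) * (1 + αR) * (1 + βR) * N} := by
  obtain ⟨c, a, -, hca⟩ := SetUnion.Input.dominated_timeBound
  -- A bound c·X^a with X = (1/ε)(1 + ln(1/γ)) log₂ m separates into a polynomial in the first two
  -- quantities and the power a of log₂ m. The constant 3 comes from log₈ m + 2 ≤ 3 log₂ m.
  refine ⟨MvPolynomial.C c * (MvPolynomial.X 0 * (1 + MvPolynomial.X 1)) ^ a, a, 3, ?_⟩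
  intro m _ U _ αL αR βL βR γ ε hm hαL hαR hβL hβR hγ hε L
  refine ⟨fun o ho => ?_, SetUnion.approximateUnion_accurate L hm hαL.2 hβL.2 hβR.1 hγ hε⟩
  let q : SetUnion.Input := ⟨(m, γ, ε), hm, hγ, hε⟩
  have hf6 := q.f₆_nonneg
  have hrhs : 0 ≤ (⌈q.p.f₅ q.m⌉₊ : ℝ) * (2 * q.p.f₆ q.m + 6) + 3 * (q.m * q.p.f₆ q.m) + 9 := by
    positivity
  obtain ⟨ht, hr, -⟩ := SetUnion.bounded_approximateUnion (A := L.A) (gen := L.gen) q.p rfl rfl rfl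
    L.size (∑ i, L.size i) hf6 (Nat.le_ceil _) o ho
  constructor
  · have hcost := q.cost_le _ (Nat.ceil_lt_add_one hrhs).le
    have htime : (o.time : ℝ) ≤ q.timeBound * q.m := le_trans (by exact_mod_cast ht) hcost
    refine htime.trans ?_
    have hb := (le_abs_self _).trans (hca q)
    calc q.timeBound * (q.m : ℝ) ≤ c * q.X ^ a * q.m := by gcongr
      _ = c * (1 / ε * (1 + Real.log (1 / γ)) * Real.logb 2 m) ^ a * m := rfl
      _ = _ := by
        simp only [map_mul, map_pow, map_add, map_one, MvPolynomial.eval_C, MvPolynomial.eval_X,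
          Matrix.cons_val_zero, Matrix.cons_val_one]
        rw [mul_pow]; ring
  · have h1 : (o.rounds : ℝ) ≤ Nat.log 8 m + 2 := by exact_mod_cast hr
    have h2 := SetUnion.three_mul_log_eight_le m
    have h3 := SetUnion.one_le_logb_two hm
    linarith
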